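/- **Setting.** Let $(X,\mathscr B,\mu)$ be a $\sigma$-finite measure space with $\mu(X)=\infty$ and $T:X\to X$ a measurable map preserving $\mu$. The transfer operator $\widehat T:L^1(\mu)\to L^1(\mu)$ is defined by $\int f\cdot(g\circ T)\,d\mu=\int(\widehat Tf)\,g\,d\mu$ for $f\in L^1(\mu)$, $g\in L^\infty(\mu)$. Assume that $T$ is conservative ergodic, i.e. $\sum_{k\ge0}\widehat T^ku=\infty$ $\mu$-a.e. for every $0\le u\in L^1(\mu)$ with $\int u\,d\mu>0$, and pointwise dual ergodic, i.e. there is a real sequence $(a'_n)$ with $\frac1{a'_n}\sum_{k=0}^{n-1}\widehat T^ku\to\int u\,d\mu$ $\mu$-a.e. for every $u\in L^1(\mu)$. Let $\alpha\in(0,1]$, and let $Y\in\mathscr B$ with $\mu(Y)>0$ be a uniform set with normalizing sequence $(a_n)$: for some $f\in L^1(\mu)$ with $\int f\,d\mu\neq0$, $\frac1{a_n}\sum_{k=0}^{n-1}\widehat T^kf\to\int f\,d\mu$ uniformly $\mu$-a.e. on $Y$ (in $L^\infty(\mu|_Y)$). Assume that $(a_n)$ is regularly varying of index $\alpha$: with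 $a(x):=a_{\lfloor x\rfloor}$, $a(xy)/a(x)\to y^\alpha$ as $x\to\infty$ for all $y>0$. Let $b$ be an asymptotic inverse of $a$, i.e. $a(b(s))\sim b(a(s))\sim s$ as $s\to\infty$, and put $\gamma(s)=1/b(1/s)$ for $s>0$. Let $(B_n)$ be measurable subsets of $Y$ with $0<\mu(B_n)<\infty$ and $\mu(B_n)\to0$, and let $\mu_{B_n}=\mu(\cdot\cap B_n)/\mu(B_n)$. For $A\in\mathscr B$ let $r_A^{(0)}=0$, $r_A^{(k+1)}(x)=\inf\{n>r_A^{(k)}(x): T^nx\in A\}$ ($\inf\emptyset=\infty$) and $\Phi_A=(r_A^{(1)},r_A^{(2)},\dots)\in[0,\infty]^{\mathbb N}$, with the product topology on $[0,\infty]^{\mathbb N}$. For random sequences $\Psi,\widetilde\Psi$ in $[0,\infty]^{\mathbb N}$ consider * (R) the processes $\gamma(\mu(B_n))\,\Phi_{B_n}$ under $\mu_{B_n}$ converge in law to $\widetilde\Psi$; * (H) for every probability $\nu\ll\mu$, the processes $\gamma(\mu(B_n))\,\Phi_{B_n}$ under $\nu$ converge in law to $\Psi$. Let $F^{[d]}$,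 $\widetilde F^{[d]}$ be the distribution functions of the first $d$ coordinates of $\Psi$, $\widetilde\Psi$, and $F^{[0]}=\widetilde F^{[0]}=1$. Say that the laws of $\Psi$ and $\widetilde\Psi$ are *related* if for all $d\ge1$ and $0\le t_1\le\dots\le t_d$ $$F^{[d]}(t_1,\dots,t_d)=\alpha\int_0^{t_1}\Bigl(\widetilde F^{[d-1]}(t_2-t_1+x,\dots,t_d-t_1+x)-\widetilde F^{[d]}(x,t_2-t_1+x,\dots,t_d-t_1+x)\Bigr)(t_1-x)^{\alpha-1}\,dx .$$ **Theorem.** 1. (R) holds for some $\widetilde\Psi$ if and only if (H) holds for some $\Psi$. 2. If (R) and (H) hold, then $\Psi$ and $\widetilde\Psi$ are almost surely nondecreasing sequences and their laws are related. 3. If $\Psi,\widetilde\Psi$ are almost surely nondecreasing sequences with related laws, then (R) holds for $\widetilde\Psi$ if and only if (H) holds for $\Psi$. 4. Among laws carried by nondecreasing sequences in $[0,\infty]$, the relation determines each of the two laws from the other: if $(P,Q)$ and $(P',Q')$ are related pairs, then $P=P'$ if and only if $Q=Q'$. -/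

import Mathlib

open MeasureTheory ProbabilityTheory Filter Topology
open scoped ENNReal

noncomputable section

namespace HittingReturn

variable {X : Type*} [MeasurableSpace X]

/-! ### Transfer operator and infinite ergodic theory -/

/-- The transfer operator of `T` on (representatives of) `L¹(μ)`: the density with respect to `μ` of
the push-forward under `T` of the signed measure `f μ`, computed from the positive and negative parts
of `f`. The theorems below show that it is integrable and satisfies the usual duality with
`L∞(μ)`, which determines it up to `μ`-null sets. -/
def transferOp (T : X → X) (μ : Measure X) (f : X → ℝ) : X → ℝ := fun x =>
  (((μ.withDensity fun y => ENNReal.ofReal (f y)).map T).rnDeriv μ x).toReal -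
    (((μ.withDensity fun y => ENNReal.ofReal (-f y)).map T).rnDeriv μ x).toReal

/-- `∑_{k < n} T̂ᵏ u`. -/
def transferSum (T : X → X) (μ : Measure X) (u : X → ℝ) (n : ℕ) (x : X) : ℝ :=
  ∑ k ∈ Finset.range n, ((transferOp T μ)^[k] u) x

theorem integrable_transferOp {T : X → X} {μ : Measure X} {f : X → ℝ} (hf : Integrable f μ) :
    Integrable (transferOp T μ f) μ := by
  have h1 := isFiniteMeasure_withDensity_ofReal hf.2
  have h2 : IsFiniteMeasure (μ.withDensity fun y => ENNReal.ofReal (-f y)) :=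
    isFiniteMeasure_withDensity_ofReal hf.neg.2
  exact Measure.integrable_toReal_rnDeriv.sub Measure.integrable_toReal_rnDeriv

theorem integral_transferOp_mul {T : X → X} {μ : Measure X} [SigmaFinite μ]
    (hT : MeasurePreserving T μ μ) {f g : X → ℝ} (hf : Integrable f μ) (hg : MemLp g ∞ μ) :
    ∫ x, f x * g (T x) ∂μ = ∫ x, transferOp T μ f x * g x ∂μ := by
  have key : ∀ h : X → ℝ, Integrable h μ →
      Integrable (fun x => (((μ.withDensity fun y => ENNReal.ofReal (h y)).map T).rnDeriv μ
        x).toReal * g x) μ ∧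
      ∫ x, (((μ.withDensity fun y => ENNReal.ofReal (h y)).map T).rnDeriv μ x).toReal * g x ∂μ =
        ∫ x, (ENNReal.ofReal (h x)).toReal * g (T x) ∂μ := by
    intro h hh
    have hfin := isFiniteMeasure_withDensity_ofReal hh.2
    have hac : (μ.withDensity fun y => ENNReal.ofReal (h y)).map T ≪ μ := by
      have := (withDensity_absolutelyContinuous μ fun y => ENNReal.ofReal (h y)).map hT.measurable
      rwa [hT.map_eq] at this
    have hgm : AEStronglyMeasurable g
        ((μ.withDensity fun y => ENNReal.ofReal (h y)).map T) := hg.1.mono_ac hac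
    refine ⟨?_, ?_⟩
    · exact (Measure.integrable_toReal_rnDeriv).mul_of_top_left hg
    · rw [integral_toReal_rnDeriv_mul hac, integral_map hT.measurable.aemeasurable hgm,
        integral_withDensity_eq_integral_toReal_smul₀ hh.1.aemeasurable.ennreal_ofReal
          (ae_of_all _ fun _ => ENNReal.ofReal_lt_top)]
      simp only [smul_eq_mul]
  have hgT : MemLp (fun x => g (T x)) ∞ μ := hg.comp_measurePreserving hT
  have int : ∀ h : X → ℝ, Integrable h μ →
      Integrable (fun x => (ENNReal.ofReal (h x)).toReal * g (T x)) μ := fun h hh => by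
    refine Integrable.mul_of_top_left ?_ hgT
    simpa only [ENNReal.toReal_ofReal'] using hh.pos_part
  have k1 := key f hf
  have k2 := key (fun y => -f y) hf.neg
  simp only [transferOp, sub_mul]
  rw [integral_sub k1.1 k2.1, k1.2, k2.2, ← integral_sub (int f hf) (int (fun y => -f y) hf.neg)]
  refine integral_congr_ae (ae_of_all _ fun x => ?_)
  simp only [ENNReal.toReal_ofReal', ← sub_mul]
  congr 1
  rcases le_total 0 (f x) with h | h
  · simp [h]
  · simp [h]

/-- Conservative ergodic measure preserving transformation: `∑ T̂ᵏ u = ∞` a.e. for every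
`0 ≤ u ∈ L¹(μ)` with `∫ u > 0`. -/
structure IsCEMPT (T : X → X) (μ : Measure X) : Prop where
  measurePreserving : MeasurePreserving T μ μ
  sum_eq_top : ∀ u : X → ℝ, Integrable u μ → 0 ≤ᵐ[μ] u → 0 < ∫ x, u x ∂μ →
    ∀ᵐ x ∂μ, Tendsto (fun n => transferSum T μ u n x) atTop atTop

/-- Pointwise dual ergodicity. -/
def PointwiseDualErgodic (T : X → X) (μ : Measure X) : Prop :=
  ∃ a : ℕ → ℝ, ∀ u : X → ℝ, Integrable u μ →
    ∀ᵐ x ∂μ, Tendsto (fun n => 1 / a n * transferSum T μ u n x) atTop (𝓝 (∫ y, u y ∂μ))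

/-- `Y` is a uniform set with normalizing sequence `a`: it is `f`-uniform for some `f ∈ L¹(μ)` with
`∫ f ≠ 0` (for `f = 0` the condition would hold for every set and every sequence). -/
def IsUniformSet (T : X → X) (μ : Measure X) (Y : Set X) (a : ℕ → ℝ) : Prop :=
  MeasurableSet Y ∧ 0 < μ Y ∧ ∃ f : X → ℝ, Integrable f μ ∧ ∫ x, f x ∂μ ≠ 0 ∧
    Tendsto (fun n => eLpNorm (fun x => 1 / a n * transferSum T μ f n x - ∫ y, f y ∂μ) ∞
      (μ.restrict Y)) atTop (𝓝 0)

/-! ### Regular variation -/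

/-- The sequence `a`, extended to real arguments by `x ↦ a ⌊x⌋`, is regularly varying of index `α`
at infinity. -/
def RegularlyVaryingSeq (a : ℕ → ℝ) (α : ℝ) : Prop :=
  ∀ y : ℝ, 0 < y → Tendsto (fun x : ℝ => a ⌊x * y⌋₊ / a ⌊x⌋₊) atTop (𝓝 (y ^ α))

/-- `b` is an asymptotic inverse of `x ↦ a ⌊x⌋`: `a (b s) ∼ b (a s) ∼ s` as `s → ∞`. -/
def IsAsymptoticInverse (a : ℕ → ℝ) (b : ℝ → ℝ) : Prop :=
  Asymptotics.IsEquivalent atTop (fun s : ℝ => a ⌊b s⌋₊) (fun s => s) ∧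
    Asymptotics.IsEquivalent atTop (fun s : ℝ => b (a ⌊s⌋₊)) (fun s => s)

/-- The scaling function `γ(s) = 1 / b(1/s)`. -/
def scaling (b : ℝ → ℝ) (s : ℝ) : ℝ := 1 / b (1 / s)

/-! ### Hitting and return times -/

/-- The `k`-th time `r_A^{(k)}` at which the orbit visits `A`, with `r_A^{(0)} = 0` and
`r_A^{(k+1)}(x) = inf {n > r_A^{(k)}(x) | Tⁿ x ∈ A}` (`= ∞` if there is no such `n`). -/
def visitTime (T : X → X) (A : Set X) : ℕ → X → ℕ∞
  | 0, _ => 0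
  | k + 1, x => ⨅ (n : ℕ) (_ : visitTime T A k x < (n : ℕ∞) ∧ T^[n] x ∈ A), (n : ℕ∞)

/-- The process `Φ_A = (r_A^{(1)}, r_A^{(2)}, …)`; coordinate `i : ℕ` is `r_A^{(i+1)}`. -/
def visitProcess (T : X → X) (A : Set X) (x : X) : ℕ → ℝ≥0∞ :=
  fun i => ((visitTime T A (i + 1) x : ℕ∞) : ℝ≥0∞)

/-- The scaled process `γ(μ(A)) Φ_A`. -/
def scaledProcess (T : X → X) (μ : Measure X) (b : ℝ → ℝ) (A : Set X) (x : X) : ℕ → ℝ≥0∞ :=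
  fun i => ENNReal.ofReal (scaling b (μ A).toReal) * visitProcess T A x i

/-! ### Convergence in law on `[0,∞]^ℕ` with the product topology -/

/-- Convergence in law of the scaled return-time processes, under `μ_{B n} = μ(· ∩ B n) / μ(B n)`,
to a process with law `P`. -/
def ReturnConverges (T : X → X) (μ : Measure X) (b : ℝ → ℝ) (B : ℕ → Set X)
    (hpos : ∀ n, μ (B n) ≠ 0) (hfin : ∀ n, μ (B n) ≠ ∞)
    (P : ProbabilityMeasure (ℕ → ℝ≥0∞)) : Prop :=
  haveI : ∀ n, IsProbabilityMeasure (μ[|B n]) := fun n =>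
    cond_isProbabilityMeasure_of_finite (hpos n) (hfin n)
  TendstoInDistribution (fun n => scaledProcess T μ b (B n)) atTop id (fun n => μ[|B n])
    (P : Measure (ℕ → ℝ≥0∞))

/-- Strong convergence in law of the scaled hitting-time processes, i.e. under every probability
`ν ≪ μ`, to a process with law `P` (the same for all `ν`). -/
def HittingConverges (T : X → X) (μ : Measure X) (b : ℝ → ℝ) (B : ℕ → Set X)
    (P : ProbabilityMeasure (ℕ → ℝ≥0∞)) : Prop :=
  ∀ (ν : Measure X) [IsProbabilityMeasure ν], ν ≪ μ →
    TendstoInDistribution (fun n => scaledProcess T μ b (B n)) atTop id (fun _ => ν)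
      (P : Measure (ℕ → ℝ≥0∞))

/-! ### Finite-dimensional distribution functions and the integral relation -/

/-- `F^{[d]}(t)`: the distribution function of the first `d` coordinates under `P`.
For `d = 0` it equals `1`. -/
def distFun (P : ProbabilityMeasure (ℕ → ℝ≥0∞)) (d : ℕ) (t : Fin d → ℝ) : ℝ :=
  (P : Measure (ℕ → ℝ≥0∞)).real {φ | ∀ i : Fin d, φ i ≤ ENNReal.ofReal (t i)}

/-- The law `P` is carried by the nondecreasing sequences in `[0,∞]`. -/
def CarriedByMonotone (P : ProbabilityMeasure (ℕ → ℝ≥0∞)) : Prop :=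
  ∀ᵐ φ ∂(P : Measure (ℕ → ℝ≥0∞)), Monotone φ

/-- The integral relation between the law `P` of the hitting limit and the law `Q` of the return
limit, for all dimensions `d + 1 ≥ 1` and all `0 ≤ t₁ ≤ ⋯ ≤ t_{d+1}`. -/
def IntegralRelation (α : ℝ) (P Q : ProbabilityMeasure (ℕ → ℝ≥0∞)) : Prop :=
  ∀ (d : ℕ) (t : Fin (d + 1) → ℝ), 0 ≤ t 0 → Monotone t →
    distFun P (d + 1) t =
      α * ∫ x in (0 : ℝ)..(t 0),
        (distFun Q d (fun i => t i.succ - t 0 + x) - distFun Q (d + 1) (fun i => t i - t 0 + x)) *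
          (t 0 - x) ^ (α - 1)

end HittingReturn

end

/-! For offsets `0 = δ 0 ≤ δ 1 ≤ …`, the constraints `φ i ≤ τ + δ i` say that one number `m_δ(φ)`
(`excess`) is at most `τ`. Hence `F^{[d+1]}(τ + δ)` is the `P`-mass of `{m_δ ≤ τ}`. Since `α ∫₀^τ
1{m ≤ x} (τ - x)^(α-1) dx = (τ - m)₊^α`, the relation becomes `P(m_δ ≤ τ) = E_Q (τ - m_δ')₊^α - E_Q
(τ - m_δ)₊^α`, where `δ'` is `δ` without its first entry (`integralRelation_iff`).

The dynamics produces this identity. Follow an orbit while the allowance `τ` shrinks by `γ` per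
step. The event `m_δ ≤ τ` is transported unchanged except at visits to `B_n`, where the first
coordinate is used up and `δ'` takes over. Telescoping and duality give an exact formula
(`integral_mul_truncPow_excess`): `∫ f 1{m_δ ≤ τ} dμ = ∫_{B_n} (S_{N'} f - S_N f) dμ`, with `S` the
partial sums of the transfer operator and `N' - 1`, `N - 1` the integer parts of `(τ - m_δ')₊ / γ`
and `(τ - m_δ)₊ / γ`. On `Y`, `S_N f` is uniformly close to `a_N ∫ f`, and regular variation gives
`μ(B_n) a(θ/γ) → θ^α` uniformly for bounded `θ`. So the right side is asymptotically `∫ f` times the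
difference of `α`-moments under `μ_{B_n}` (`tendsto_hitting_sub_return`).

The function `f` is the special one from the uniform set. Integrating once in `τ` makes the test
functions continuous, and the hitting test functions become asymptotically `T`-invariant. Weak-*
compactness and ergodicity then allow `f / ∫ f` to be replaced by the density of any `ν ≪ μ`
(`tendsto_integral_mul_of_asymptotically_invariant`).

Thus hitting and return laws are asymptotically related. The space `[0,∞]^ℕ` is compact, so along
every ultrafilter the laws converge, and their limits are related. Each law determines the other:
`P` from `Q` by reading the formula, `Q` from `P` by induction on the dimension, inverting the
fractional integral. So all ultralimits of one family agree once the other converges, which yields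
all four claims. -/

noncomputable section

namespace HittingReturn

/-! ### Truncated powers -/

/-- `(τ - m)₊`, as a real number. -/
def slack (τ : ℝ) (m : ℝ≥0∞) : ℝ := (ENNReal.ofReal τ - m).toReal

/-- `(τ - m)^p` if `m ≤ τ`, and `0` otherwise. -/
def truncPow (p τ : ℝ) (m : ℝ≥0∞) : ℝ :=
  if m ≤ ENNReal.ofReal τ then slack τ m ^ p else 0

/-- `∫₀¹ u ^ p (1 - u) ^ (q - 1) du`. -/
def betaConst (p q : ℝ) : ℝ := ∫ u in (0 : ℝ)..1, u ^ p * (1 - u) ^ (q - 1)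

theorem slack_nonneg (τ : ℝ) (m : ℝ≥0∞) : 0 ≤ slack τ m := ENNReal.toReal_nonneg

theorem slack_le {τ : ℝ} (hτ : 0 ≤ τ) (m : ℝ≥0∞) : slack τ m ≤ τ := by
  have := ENNReal.toReal_mono ENNReal.ofReal_ne_top (tsub_le_self (a := ENNReal.ofReal τ) (b := m))
  rwa [ENNReal.toReal_ofReal hτ] at this

theorem slack_of_lt {τ : ℝ} {m : ℝ≥0∞} (h : ENNReal.ofReal τ < m) : slack τ m = 0 := by
  simp [slack, tsub_eq_zero_of_le h.le]

theorem slack_of_le {τ : ℝ} (hτ : 0 ≤ τ) {m : ℝ≥0∞} (h : m ≤ ENNReal.ofReal τ) :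
    slack τ m = τ - m.toReal := by
  rw [slack, ENNReal.toReal_sub_of_le h ENNReal.ofReal_ne_top, ENNReal.toReal_ofReal hτ]

theorem slack_mono {τ σ : ℝ} (h : τ ≤ σ) (m : ℝ≥0∞) : slack τ m ≤ slack σ m :=
  ENNReal.toReal_mono (ENNReal.sub_ne_top ENNReal.ofReal_ne_top)
    (tsub_le_tsub_right (ENNReal.ofReal_le_ofReal h) m)

theorem slack_add_le {τ h : ℝ} (hh : 0 ≤ h) (m : ℝ≥0∞) : slack (τ + h) m ≤ slack τ m + h := by
  have h1 : ENNReal.ofReal (τ + h) - m ≤ (ENNReal.ofReal τ - m) + ENNReal.ofReal h := by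
    rw [tsub_le_iff_right]
    calc ENNReal.ofReal (τ + h) ≤ ENNReal.ofReal τ + ENNReal.ofReal h := ENNReal.ofReal_add_le
      _ ≤ (ENNReal.ofReal τ - m + m) + ENNReal.ofReal h := by gcongr; exact le_tsub_add
      _ = _ := by ring
  have h3 : ENNReal.ofReal τ - m ≠ ∞ := ENNReal.sub_ne_top ENNReal.ofReal_ne_top
  have h2 := ENNReal.toReal_mono (ENNReal.add_ne_top.2 ⟨h3, ENNReal.ofReal_ne_top⟩) h1
  rwa [ENNReal.toReal_add h3 ENNReal.ofReal_ne_top, ENNReal.toReal_ofReal hh] at h2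

theorem continuous_slack (τ : ℝ) : Continuous (slack τ) := by
  rw [← continuousOn_univ]
  refine ENNReal.continuousOn_toReal.comp
    (ENNReal.continuous_sub_left ENNReal.ofReal_ne_top).continuousOn fun m _ => ?_
  exact ENNReal.sub_ne_top ENNReal.ofReal_ne_top

theorem truncPow_of_pos {p : ℝ} (hp : 0 < p) (τ : ℝ) (m : ℝ≥0∞) :
    truncPow p τ m = slack τ m ^ p := by
  unfold truncPow
  split_ifs with h
  · rfl
  · rw [slack_of_lt (not_le.1 h), Real.zero_rpow hp.ne']

theorem truncPow_zero (τ : ℝ) (m : ℝ≥0∞) :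
    truncPow 0 τ m = if m ≤ ENNReal.ofReal τ then 1 else 0 := by
  simp [truncPow]

theorem truncPow_one (τ : ℝ) (m : ℝ≥0∞) : truncPow 1 τ m = slack τ m := by
  rw [truncPow_of_pos one_pos, Real.rpow_one]

theorem truncPow_nonneg (p τ : ℝ) (m : ℝ≥0∞) : 0 ≤ truncPow p τ m := by
  unfold truncPow
  split_ifs
  · exact Real.rpow_nonneg (slack_nonneg _ _) _
  · exact le_rfl

theorem truncPow_le {p τ σ : ℝ} (hp : 0 ≤ p) (hσ : 0 ≤ σ) (hτ : τ ≤ σ) (m : ℝ≥0∞) :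
    truncPow p τ m ≤ σ ^ p := by
  unfold truncPow
  split_ifs
  · exact Real.rpow_le_rpow (slack_nonneg _ _) ((slack_mono hτ m).trans (slack_le hσ m)) hp
  · exact Real.rpow_nonneg hσ _

theorem abs_truncPow_le {p τ σ : ℝ} (hp : 0 ≤ p) (hσ : 0 ≤ σ) (hτ : τ ≤ σ) (m : ℝ≥0∞) :
    |truncPow p τ m| ≤ σ ^ p := by
  rw [abs_of_nonneg (truncPow_nonneg _ _ _)]
  exact truncPow_le hp hσ hτ m

/-- Positive order is what makes truncated powers admissible against weak convergence; at order `0`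
there is a jump at `m = τ`. -/
theorem continuous_truncPow {p : ℝ} (hp : 0 < p) (τ : ℝ) : Continuous (truncPow p τ) := by
  rw [funext (truncPow_of_pos hp τ)]
  exact (continuous_slack τ).rpow_const fun _ => Or.inr hp.le

theorem measurable_truncPow_uncurry (p : ℝ) :
    Measurable fun z : ℝ × ℝ≥0∞ => truncPow p z.1 z.2 := by
  have h1 : Measurable fun z : ℝ × ℝ≥0∞ => ENNReal.ofReal z.1 := by fun_prop
  refine Measurable.ite (measurableSet_le measurable_snd h1) ?_ measurable_const
  exact ((h1.sub measurable_snd).ennreal_toReal).pow_const p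

theorem measurable_truncPow (p τ : ℝ) : Measurable (truncPow p τ) :=
  (measurable_truncPow_uncurry p).comp (measurable_const.prodMk measurable_id)

theorem intervalIntegrable_sub_rpow (a τ : ℝ) {q : ℝ} (hq : 0 < q) :
    IntervalIntegrable (fun x : ℝ => (τ - x) ^ (q - 1)) volume a τ := by
  have := (intervalIntegral.intervalIntegrable_rpow' (a := τ - a) (b := 0) (r := q - 1)
    (by linarith)).comp_sub_left τ
  simpa using this

theorem betaConst_pos {p q : ℝ} (hp : 0 ≤ p) (hq : 0 < q) : 0 < betaConst p q := by
  refine intervalIntegral.intervalIntegral_pos_of_pos_on ?_ ?_ one_pos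
  · exact (intervalIntegrable_sub_rpow 0 1 hq).continuousOn_mul
      (Real.continuous_rpow_const hp).continuousOn
  · intro x hx
    exact mul_pos (Real.rpow_pos_of_pos hx.1 _) (Real.rpow_pos_of_pos (by linarith [hx.2]) _)

theorem betaConst_one_right {p : ℝ} (hp : 0 ≤ p) : betaConst p 1 = 1 / (p + 1) := by
  simp only [betaConst, sub_self, Real.rpow_zero, mul_one]
  rw [integral_rpow (Or.inl (by linarith))]
  simp [Real.zero_rpow (by linarith : p + 1 ≠ 0)]

theorem betaConst_zero_left {q : ℝ} (hq : 0 < q) : betaConst 0 q = 1 / q := by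
  simp only [betaConst, Real.rpow_zero, one_mul]
  rw [intervalIntegral.integral_comp_sub_left (fun x => x ^ (q - 1)) 1,
    integral_rpow (Or.inl (by linarith))]
  simp [Real.zero_rpow hq.ne']

/-- Fractional integration raises the exponent of a truncated power. -/
theorem integral_truncPow_mul {p q τ : ℝ} (hp : 0 ≤ p) (hq : 0 < q) (hτ : 0 ≤ τ) (m : ℝ≥0∞) :
    ∫ x in (0 : ℝ)..τ, truncPow p x m * (τ - x) ^ (q - 1) =
      betaConst p q * truncPow (p + q) τ m := by
  by_cases hm : m ≤ ENNReal.ofReal τ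
  swap
  · rw [truncPow, if_neg hm, mul_zero]
    refine intervalIntegral.integral_zero_ae (ae_of_all _ fun x hx => ?_)
    rw [Set.uIoc_of_le hτ] at hx
    rw [truncPow, if_neg fun h => hm (h.trans (ENNReal.ofReal_le_ofReal hx.2)), zero_mul]
  have hmt : m ≠ ∞ := ne_top_of_le_ne_top ENNReal.ofReal_ne_top hm
  obtain ⟨a, ha, rfl⟩ : ∃ a : ℝ, 0 ≤ a ∧ m = ENNReal.ofReal a :=
    ⟨m.toReal, ENNReal.toReal_nonneg, (ENNReal.ofReal_toReal hmt).symm⟩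
  have haτ : a ≤ τ := (ENNReal.ofReal_le_ofReal_iff hτ).1 hm
  have key : ∀ r x, a ≤ x → truncPow r x (ENNReal.ofReal a) = (x - a) ^ r := fun r x hx => by
    rw [truncPow, if_pos (ENNReal.ofReal_le_ofReal hx),
      slack_of_le (ha.trans hx) (ENNReal.ofReal_le_ofReal hx), ENNReal.toReal_ofReal ha]
  -- Only almost everywhere: at `x = a` and `p = 0` the truncated power equals `1`.
  have h0 : ∀ᵐ x ∂volume, x ∈ Set.uIoc 0 a →
      truncPow p x (ENNReal.ofReal a) * (τ - x) ^ (q - 1) = 0 := by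
    have : ∀ᵐ x : ℝ ∂volume, x ≠ a := by simp [ae_iff, measure_singleton]
    filter_upwards [this] with x hx hx'
    rw [Set.uIoc_of_le ha] at hx'
    have hlt : x < a := lt_of_le_of_ne hx'.2 hx
    rw [truncPow, if_neg, zero_mul]
    rw [ENNReal.ofReal_le_ofReal_iff hx'.1.le]
    exact not_le.2 hlt
  have h1 : Set.EqOn (fun x => truncPow p x (ENNReal.ofReal a) * (τ - x) ^ (q - 1))
      (fun x => (x - a) ^ p * (τ - x) ^ (q - 1)) (Set.uIcc a τ) := by
    intro x hx
    rw [Set.uIcc_of_le haτ] at hx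
    simp only [key p x hx.1]
  have i1 : IntervalIntegrable (fun x => (x - a) ^ p * (τ - x) ^ (q - 1)) volume a τ :=
    (intervalIntegrable_sub_rpow a τ hq).continuousOn_mul
      ((continuous_id.sub continuous_const).rpow_const fun _ => Or.inr hp).continuousOn
  have i1' : IntervalIntegrable (fun x => truncPow p x (ENNReal.ofReal a) * (τ - x) ^ (q - 1))
      volume a τ := i1.congr (h1.symm.mono Set.uIoc_subset_uIcc)
  have i0 : IntervalIntegrable (fun x => truncPow p x (ENNReal.ofReal a) * (τ - x) ^ (q - 1))
      volume 0 a := by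
    refine (intervalIntegrable_const (c := (0 : ℝ))).congr_ae ?_
    rw [Filter.EventuallyEq, ae_restrict_iff' measurableSet_uIoc]
    filter_upwards [h0] with x hx hx' using (hx hx').symm
  rw [← intervalIntegral.integral_add_adjacent_intervals i0 i1',
    intervalIntegral.integral_zero_ae h0, zero_add, intervalIntegral.integral_congr h1,
    key _ τ haτ]
  rcases haτ.eq_or_lt with rfl | hlt
  · simp [Real.zero_rpow (by linarith : p + q ≠ 0)]
  have hc : 0 < τ - a := by linarith
  -- The substitution `x = (τ - a) u + a` reduces the integral over `[a, τ]` to the Beta integral.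
  have hsub := intervalIntegral.integral_comp_mul_add
    (f := fun x => (x - a) ^ p * (τ - x) ^ (q - 1)) (a := 0) (b := 1) hc.ne' a
  simp only [mul_zero, zero_add, mul_one, sub_add_cancel, smul_eq_mul] at hsub
  have h2 : ∫ u in (0 : ℝ)..1, ((τ - a) * u + a - a) ^ p * (τ - ((τ - a) * u + a)) ^ (q - 1) =
      (τ - a) ^ (p + q - 1) * betaConst p q := by
    rw [betaConst, ← intervalIntegral.integral_const_mul]
    refine intervalIntegral.integral_congr fun u hu => ?_
    rw [Set.uIcc_of_le zero_le_one] at hu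
    have e1 : (τ - a) * u + a - a = (τ - a) * u := by ring
    have e2 : τ - ((τ - a) * u + a) = (τ - a) * (1 - u) := by ring
    simp only [e1, e2]
    rw [Real.mul_rpow hc.le hu.1, Real.mul_rpow hc.le (by linarith [hu.2]),
      show p + q - 1 = p + (q - 1) by ring, Real.rpow_add hc]
    ring
  rw [h2] at hsub
  have h3 : (τ - a) ^ (p + q) = (τ - a) * (τ - a) ^ (p + q - 1) := by
    rw [Real.rpow_sub_one hc.ne']; field_simp
  rw [h3, mul_comm (betaConst p q), mul_assoc, hsub, ← mul_assoc, mul_inv_cancel₀ hc.ne', one_mul]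

/-! ### Fractional integration and differentiation of truncated moments -/

section Measure

variable {Ω : Type*} [MeasurableSpace Ω]

/-- On `(0, τ]` the truncated power is at most `τ ^ p`, so `τ ^ p |f ω| (τ - x) ^ (q - 1)`
dominates. This justifies Fubini even when the kernel is singular at `x = τ`. -/
theorem integrable_mul_truncPow_prod {μ : Measure Ω} [SFinite μ] {f : Ω → ℝ}
    (hf : Integrable f μ) {M : Ω → ℝ≥0∞} (hM : Measurable M) {p q τ : ℝ} (hp : 0 ≤ p) (hq : 0 < q)
    (hτ : 0 ≤ τ) :
    Integrable (Function.uncurry fun x ω => f ω * truncPow p x (M ω) * (τ - x) ^ (q - 1))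
      ((volume.restrict (Set.uIoc 0 τ)).prod μ) := by
  have h1 : Integrable (fun x : ℝ => (τ - x) ^ (q - 1)) (volume.restrict (Set.uIoc 0 τ)) := by
    have := intervalIntegrable_sub_rpow 0 τ hq
    rwa [intervalIntegrable_iff] at this
  have h2 := h1.mul_prod hf
  have h3 : ∀ᵐ z ∂((volume.restrict (Set.uIoc 0 τ)).prod μ), z.1 ∈ Set.uIoc 0 τ :=
    Measure.quasiMeasurePreserving_fst.ae (ae_restrict_mem measurableSet_uIoc)
  have hm : Measurable fun z : ℝ × Ω => truncPow p z.1 (M z.2) :=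
    (measurable_truncPow_uncurry p).comp (measurable_fst.prodMk (hM.comp measurable_snd))
  have h4 := h2.bdd_mul (c := τ ^ p) hm.aestronglyMeasurable (by
    filter_upwards [h3] with z hz
    rw [Set.uIoc_of_le hτ] at hz
    rw [Real.norm_eq_abs]
    exact abs_truncPow_le hp hτ hz.2 _)
  refine h4.congr (ae_of_all _ fun z => ?_)
  simp only [Function.uncurry]
  ring

/-- Fractional integration of integrated truncated powers. -/
theorem integral_integral_truncPow {μ : Measure Ω} [SFinite μ] {f : Ω → ℝ}
    (hf : Integrable f μ) {M : Ω → ℝ≥0∞} (hM : Measurable M) {p q τ : ℝ} (hp : 0 ≤ p) (hq : 0 < q)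
    (hτ : 0 ≤ τ) :
    ∫ x in (0 : ℝ)..τ, (∫ ω, f ω * truncPow p x (M ω) ∂μ) * (τ - x) ^ (q - 1) =
      betaConst p q * ∫ ω, f ω * truncPow (p + q) τ (M ω) ∂μ := by
  simp only [← integral_mul_const]
  rw [intervalIntegral_integral_swap (integrable_mul_truncPow_prod hf hM hp hq hτ),
    ← integral_const_mul]
  refine integral_congr_ae (ae_of_all _ fun ω => ?_)
  simp only [mul_assoc]
  rw [intervalIntegral.integral_const_mul, integral_truncPow_mul hp hq hτ]
  ring

theorem intervalIntegrable_integral_truncPow {μ : Measure Ω} [SFinite μ] {f : Ω → ℝ}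
    (hf : Integrable f μ) {M : Ω → ℝ≥0∞} (hM : Measurable M) {p q τ : ℝ} (hp : 0 ≤ p) (hq : 0 < q)
    (hτ : 0 ≤ τ) :
    IntervalIntegrable (fun x => (∫ ω, f ω * truncPow p x (M ω) ∂μ) * (τ - x) ^ (q - 1))
      volume 0 τ := by
  simp only [← integral_mul_const]
  rw [intervalIntegrable_iff]
  exact (integrable_mul_truncPow_prod hf hM hp hq hτ).integral_prod_left

/-- Mean value bound; it dominates the difference quotients of truncated powers. -/
theorem rpow_sub_rpow_le {p x y K : ℝ} (hp : 0 ≤ p) (hx : 0 ≤ x) (hxy : x ≤ y) (hy : y ≤ K) :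
    y ^ (p + 1) - x ^ (p + 1) ≤ (p + 1) * K ^ p * (y - x) := by
  refine Convex.image_sub_le_mul_sub_of_deriv_le (convex_Icc 0 K)
    (Real.continuous_rpow_const (by linarith)).continuousOn
    (fun z _ => (Real.hasDerivAt_rpow_const
      (Or.inr (by linarith))).differentiableAt.differentiableWithinAt)
    (fun z hz => ?_) x ⟨hx, hxy.trans hy⟩ y ⟨hx.trans hxy, hy⟩ hxy
  rw [interior_Icc] at hz
  rw [(Real.hasDerivAt_rpow_const (Or.inr (by linarith))).deriv, add_sub_cancel_right]
  have := Real.rpow_le_rpow hz.1.le hz.2.le hp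
  gcongr

theorem integrable_truncPow {Q : Measure Ω} [IsFiniteMeasure Q] {M : Ω → ℝ≥0∞}
    (hM : Measurable M) {p τ : ℝ} (hp : 0 ≤ p) (hτ : 0 ≤ τ) :
    Integrable (fun ω => truncPow p τ (M ω)) Q :=
  Integrable.of_bound (C := τ ^ p) ((measurable_truncPow p τ).comp hM).aestronglyMeasurable
    (ae_of_all _ fun _ => abs_truncPow_le hp hτ le_rfl _)

/-- The right derivative of an integrated truncated power. -/
theorem tendsto_slope_integral_truncPow (Q : Measure Ω) [IsFiniteMeasure Q] {M : Ω → ℝ≥0∞}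
    (hM : Measurable M) {p τ : ℝ} (hp : 0 ≤ p) (hτ : 0 ≤ τ) :
    Tendsto (fun n : ℕ => ((n : ℝ) + 1) * (∫ ω, truncPow (p + 1) (τ + 1 / ((n : ℝ) + 1)) (M ω) ∂Q -
      ∫ ω, truncPow (p + 1) τ (M ω) ∂Q)) atTop (𝓝 ((p + 1) * ∫ ω, truncPow p τ (M ω) ∂Q)) := by
  have hp1 : 0 < p + 1 := by linarith
  have hpos : ∀ n : ℕ, 0 < (n : ℝ) + 1 := fun n => by positivity
  have h1 : ∀ n : ℕ, 1 / ((n : ℝ) + 1) ≤ 1 := fun n => by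
    rw [div_le_one (hpos n)]; linarith [n.cast_nonneg (α := ℝ)]
  have h0 : ∀ n : ℕ, 0 < 1 / ((n : ℝ) + 1) := fun n => by positivity
  have hrw : ∀ n : ℕ, ((n : ℝ) + 1) * (∫ ω, truncPow (p + 1) (τ + 1 / ((n : ℝ) + 1)) (M ω) ∂Q -
      ∫ ω, truncPow (p + 1) τ (M ω) ∂Q) = ∫ ω, ((n : ℝ) + 1) *
        (truncPow (p + 1) (τ + 1 / ((n : ℝ) + 1)) (M ω) - truncPow (p + 1) τ (M ω)) ∂Q :=
    fun n => by
    rw [integral_const_mul, integral_sub (integrable_truncPow hM hp1.le (by linarith [h0 n]))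
      (integrable_truncPow hM hp1.le hτ)]
  simp only [hrw]
  rw [← integral_const_mul]
  refine tendsto_integral_of_dominated_convergence (fun _ => (p + 1) * (τ + 1) ^ p) (fun n => ?_)
    (integrable_const _) (fun n => ae_of_all _ fun ω => ?_) (ae_of_all _ fun ω => ?_)
  · exact ((((measurable_truncPow _ _).comp hM).sub
      ((measurable_truncPow _ _).comp hM)).const_mul _).aestronglyMeasurable
  · rw [truncPow_of_pos hp1, truncPow_of_pos hp1, Real.norm_eq_abs, abs_of_nonneg]
    · have h2 := rpow_sub_rpow_le hp (slack_nonneg τ (M ω))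
        (slack_mono (le_add_of_nonneg_right (h0 n).le) (M ω))
        ((slack_le (by linarith [h0 n]) (M ω)).trans
          (by linarith [h1 n] : τ + 1 / ((n : ℝ) + 1) ≤ τ + 1))
      have h3 := slack_add_le (τ := τ) (h0 n).le (M ω)
      calc ((n : ℝ) + 1) * _ ≤ ((n : ℝ) + 1) * ((p + 1) * (τ + 1) ^ p * (1 / ((n : ℝ) + 1))) := by
            refine mul_le_mul_of_nonneg_left (h2.trans ?_) (hpos n).le
            refine mul_le_mul_of_nonneg_left (by linarith) ?_
            exact mul_nonneg hp1.le (Real.rpow_nonneg (by linarith) _)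
        _ = _ := by have := (hpos n).ne'; field_simp
    · refine mul_nonneg (hpos n).le (sub_nonneg.2 ?_)
      exact Real.rpow_le_rpow (slack_nonneg _ _) (slack_mono (le_add_of_nonneg_right (h0 n).le) _)
        hp1.le
  · have hlim : Tendsto (fun n : ℕ => 1 / ((n : ℝ) + 1)) atTop (𝓝 0) :=
      tendsto_one_div_add_atTop_nhds_zero_nat
    -- The derivative is taken from the right, so the boundary case `M ω = τ` belongs to the first
    -- branch; for `p = 0` the limit there is `1`, matching the convention `m ≤ τ` in `truncPow`.
    by_cases hm : M ω ≤ ENNReal.ofReal τ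
    · have hx := Real.hasDerivAt_rpow_const (x := slack τ (M ω)) (p := p + 1) (Or.inr (by linarith))
      rw [hasDerivAt_iff_tendsto_slope_zero, add_sub_cancel_right] at hx
      have h4 : Tendsto (fun n : ℕ => 1 / ((n : ℝ) + 1)) atTop (𝓝[≠] 0) :=
        tendsto_nhdsWithin_iff.2 ⟨hlim, .of_forall fun n => (h0 n).ne'⟩
      have h5 := hx.comp h4
      rw [show truncPow p τ (M ω) = slack τ (M ω) ^ p from if_pos hm]
      refine h5.congr fun n => ?_
      have hm' : M ω ≤ ENNReal.ofReal (τ + 1 / ((n : ℝ) + 1)) :=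
        hm.trans (ENNReal.ofReal_le_ofReal (by linarith [h0 n]))
      rw [Function.comp_apply, truncPow_of_pos hp1, truncPow_of_pos hp1, slack_of_le hτ hm,
        slack_of_le (by linarith [h0 n]) hm', smul_eq_mul, one_div, inv_inv]
      congr 3
      ring
    · rw [show truncPow p τ (M ω) = 0 from if_neg hm, mul_zero]
      have h5 : Tendsto (fun n : ℕ => ENNReal.ofReal (τ + 1 / ((n : ℝ) + 1))) atTop
          (𝓝 (ENNReal.ofReal τ)) := by
        refine ENNReal.tendsto_ofReal ?_
        simpa using hlim.const_add τ
      refine tendsto_const_nhds.congr' ?_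
      filter_upwards [h5.eventually (gt_mem_nhds (not_le.1 hm))] with n hn
      rw [truncPow, if_neg (not_le.2 hn), truncPow, if_neg hm, sub_zero, mul_zero]

/-- Truncated moments of order `p + 1` determine those of order `p`. -/
theorem integral_truncPow_eq_of_add_one {Ω' : Type*} [MeasurableSpace Ω'] {Q : Measure Ω}
    {Q' : Measure Ω'} [IsFiniteMeasure Q] [IsFiniteMeasure Q'] {M : Ω → ℝ≥0∞} {M' : Ω' → ℝ≥0∞}
    (hM : Measurable M) (hM' : Measurable M') {p : ℝ} (hp : 0 ≤ p)
    (h : ∀ τ, 0 ≤ τ → ∫ ω, truncPow (p + 1) τ (M ω) ∂Q = ∫ ω, truncPow (p + 1) τ (M' ω) ∂Q')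
    {τ : ℝ} (hτ : 0 ≤ τ) : ∫ ω, truncPow p τ (M ω) ∂Q = ∫ ω, truncPow p τ (M' ω) ∂Q' := by
  have h1 := tendsto_slope_integral_truncPow Q hM hp hτ
  have h2 := tendsto_slope_integral_truncPow Q' hM' hp hτ
  have h3 := tendsto_nhds_unique h1 (h2.congr fun n => by
    rw [h τ hτ, h _ (add_nonneg hτ (by positivity))])
  exact mul_left_cancel₀ (by linarith) h3

/-- Inversion of the fractional integral: raise the order from `α` to the integer `2` by a further
fractional integration, then differentiate twice. -/
theorem integral_truncPow_zero_eq_of_pos {Q Q' : Measure Ω} [IsFiniteMeasure Q]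
    [IsFiniteMeasure Q'] {M : Ω → ℝ≥0∞} (hM : Measurable M) {α : ℝ} (hα₀ : 0 < α) (hα₁ : α ≤ 1)
    (h : ∀ τ, 0 ≤ τ → ∫ ω, truncPow α τ (M ω) ∂Q = ∫ ω, truncPow α τ (M ω) ∂Q')
    {τ : ℝ} (hτ : 0 ≤ τ) : ∫ ω, truncPow 0 τ (M ω) ∂Q = ∫ ω, truncPow 0 τ (M ω) ∂Q' := by
  have key : ∀ τ, 0 ≤ τ → ∫ ω, truncPow (0 + 1 + 1) τ (M ω) ∂Q =
      ∫ ω, truncPow (0 + 1 + 1) τ (M ω) ∂Q' := fun τ hτ => by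
    -- The complementary order `2 - α` is positive because `α ≤ 1`, and `α + (2 - α) = 0 + 1 + 1`.
    have h1 := integral_integral_truncPow (integrable_const (μ := Q) (1 : ℝ)) hM hα₀.le
      (q := 2 - α) (by linarith) hτ
    have h2 := integral_integral_truncPow (integrable_const (μ := Q') (1 : ℝ)) hM hα₀.le
      (q := 2 - α) (by linarith) hτ
    simp only [one_mul] at h1 h2
    have h3 : ∫ x in (0 : ℝ)..τ, (∫ ω, truncPow α x (M ω) ∂Q) * (τ - x) ^ (2 - α - 1) =
        ∫ x in (0 : ℝ)..τ, (∫ ω, truncPow α x (M ω) ∂Q') * (τ - x) ^ (2 - α - 1) := by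
      refine intervalIntegral.integral_congr fun x hx => ?_
      rw [Set.uIcc_of_le hτ] at hx
      simp only [h x hx.1]
    rw [h1, h2, add_sub_cancel] at h3
    rw [show (0 : ℝ) + 1 + 1 = 2 by norm_num]
    exact mul_left_cancel₀ (betaConst_pos hα₀.le (by linarith)).ne' h3
  exact integral_truncPow_eq_of_add_one hM hM le_rfl (fun τ hτ =>
    integral_truncPow_eq_of_add_one hM hM (by norm_num) key hτ) hτ

end Measure

/-! ### The integral relation in terms of truncated moments -/

/-- The smallest `τ ≥ 0` with `φ i ≤ τ + δ i` for all `i < d`. -/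
def excess {d : ℕ} (δ : Fin d → ℝ) (φ : ℕ → ℝ≥0∞) : ℝ≥0∞ :=
  ⨆ i : Fin d, (φ i - ENNReal.ofReal (δ i))

theorem excess_le_iff {d : ℕ} {δ : Fin d → ℝ} {φ : ℕ → ℝ≥0∞} {c : ℝ≥0∞} :
    excess δ φ ≤ c ↔ ∀ i : Fin d, φ i ≤ c + ENNReal.ofReal (δ i) := by
  simp [excess, iSup_le_iff, tsub_le_iff_right]

theorem excess_le_ofReal_iff {d : ℕ} {δ : Fin d → ℝ} (hδ : ∀ i, 0 ≤ δ i) {φ : ℕ → ℝ≥0∞} {τ : ℝ}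
    (hτ : 0 ≤ τ) :
    excess δ φ ≤ ENNReal.ofReal τ ↔ ∀ i : Fin d, φ i ≤ ENNReal.ofReal (τ + δ i) := by
  simp only [excess_le_iff, ENNReal.ofReal_add hτ (hδ _)]

theorem continuous_excess {d : ℕ} (δ : Fin d → ℝ) : Continuous (excess δ) := by
  have : excess δ = fun φ => Finset.univ.sup fun i : Fin d => φ i - ENNReal.ofReal (δ i) := by
    ext φ
    rw [Finset.sup_univ_eq_iSup, excess]
  rw [this]
  exact Continuous.finset_sup_apply fun i _ =>
    (ENNReal.continuous_sub_right _).comp (continuous_apply _)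

theorem measurable_excess {d : ℕ} (δ : Fin d → ℝ) : Measurable (excess δ) :=
  (continuous_excess δ).measurable

theorem distFun_eq_integral_truncPow (P : ProbabilityMeasure (ℕ → ℝ≥0∞)) {d : ℕ} {δ : Fin d → ℝ}
    (hδ : ∀ i, 0 ≤ δ i) {τ : ℝ} (hτ : 0 ≤ τ) :
    distFun P d (fun i => τ + δ i) =
      ∫ φ, truncPow 0 τ (excess δ φ) ∂(P : Measure (ℕ → ℝ≥0∞)) := by
  have hS : MeasurableSet {φ : ℕ → ℝ≥0∞ | excess δ φ ≤ ENNReal.ofReal τ} :=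
    measurableSet_le (measurable_excess δ) measurable_const
  have h1 : (fun φ => truncPow 0 τ (excess δ φ)) =
      Set.indicator {φ : ℕ → ℝ≥0∞ | excess δ φ ≤ ENNReal.ofReal τ} 1 := by
    ext φ
    simp [truncPow_zero, Set.indicator_apply]
  rw [h1, integral_indicator_one hS, distFun]
  simp only [excess_le_ofReal_iff hδ hτ]

/-- A distribution function along a diagonal is a moment of order `0`; fractional integration raises
it to order `α`, and the prefactor `α` cancels `betaConst 0 α = 1 / α`. -/
theorem fractional_integral_distFun (Q : ProbabilityMeasure (ℕ → ℝ≥0∞)) {α : ℝ} (hα : 0 < α)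
    {d : ℕ} {δ : Fin d → ℝ} (hδ : ∀ i, 0 ≤ δ i) {τ : ℝ} (hτ : 0 ≤ τ) :
    IntervalIntegrable (fun x => distFun Q d (fun i => δ i + x) * (τ - x) ^ (α - 1)) volume 0 τ ∧
    α * ∫ x in (0 : ℝ)..τ, distFun Q d (fun i => δ i + x) * (τ - x) ^ (α - 1) =
      ∫ φ, truncPow α τ (excess δ φ) ∂(Q : Measure (ℕ → ℝ≥0∞)) := by
  have h1 : Set.EqOn (fun x => distFun Q d (fun i => δ i + x) * (τ - x) ^ (α - 1))
      (fun x => (∫ φ, 1 * truncPow 0 x (excess δ φ) ∂(Q : Measure (ℕ → ℝ≥0∞))) *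
        (τ - x) ^ (α - 1)) (Set.uIcc 0 τ) := fun x hx => by
    rw [Set.uIcc_of_le hτ] at hx
    simp only [one_mul, ← distFun_eq_integral_truncPow Q hδ hx.1, add_comm]
  have hi := integrable_const (μ := (Q : Measure (ℕ → ℝ≥0∞))) (1 : ℝ)
  refine ⟨(intervalIntegrable_integral_truncPow hi (measurable_excess δ) le_rfl hα hτ).congr
    (h1.symm.mono Set.uIoc_subset_uIcc), ?_⟩
  rw [intervalIntegral.integral_congr h1,
    integral_integral_truncPow hi (measurable_excess δ) le_rfl hα hτ, betaConst_zero_left hα,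
    zero_add]
  simp only [one_mul]
  field_simp

/-- The change of variables is `τ = t 0`, `δ i = t i - t 0`; both distribution functions under the
integral then depend on `x` only along a diagonal. -/
theorem integralRelation_iff {α : ℝ} (hα : 0 < α) (P Q : ProbabilityMeasure (ℕ → ℝ≥0∞)) :
    IntegralRelation α P Q ↔ ∀ (d : ℕ) (δ : Fin (d + 1) → ℝ), δ 0 = 0 → Monotone δ →
      ∀ τ : ℝ, 0 ≤ τ → ∫ φ, truncPow 0 τ (excess δ φ) ∂(P : Measure (ℕ → ℝ≥0∞)) =
        ∫ φ, truncPow α τ (excess (fun i => δ i.succ) φ) ∂(Q : Measure (ℕ → ℝ≥0∞)) -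
          ∫ φ, truncPow α τ (excess δ φ) ∂(Q : Measure (ℕ → ℝ≥0∞)) := by
  have key : ∀ (d : ℕ) (δ : Fin (d + 1) → ℝ), (∀ i, 0 ≤ δ i) → ∀ τ : ℝ, 0 ≤ τ →
      α * ∫ x in (0 : ℝ)..τ, (distFun Q d (fun i => δ i.succ + x) -
          distFun Q (d + 1) (fun i => δ i + x)) * (τ - x) ^ (α - 1) =
        ∫ φ, truncPow α τ (excess (fun i => δ i.succ) φ) ∂(Q : Measure (ℕ → ℝ≥0∞)) -
          ∫ φ, truncPow α τ (excess δ φ) ∂(Q : Measure (ℕ → ℝ≥0∞)) := by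
    intro d δ hδ τ hτ
    obtain ⟨i1, e1⟩ := fractional_integral_distFun Q hα (fun i : Fin d => hδ i.succ) hτ
    obtain ⟨i2, e2⟩ := fractional_integral_distFun Q hα hδ hτ
    simp only [sub_mul]
    rw [intervalIntegral.integral_sub i1 i2, mul_sub, e1, e2]
  constructor
  · intro h d δ h0 hmono τ hτ
    have hδ : ∀ i, 0 ≤ δ i := fun i => h0 ▸ hmono (Fin.zero_le i)
    have h1 := h d (fun i => τ + δ i) (by simpa [h0] using hτ) fun i j hij => by
      simpa using hmono hij
    rw [distFun_eq_integral_truncPow P hδ hτ] at h1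
    simp only [h0, add_zero, add_sub_cancel_left] at h1
    rw [h1, key d δ hδ τ hτ]
  · intro h d t h0 hmono
    have hδ : ∀ i, 0 ≤ t i - t 0 := fun i => sub_nonneg.2 (hmono (Fin.zero_le i))
    rw [key d (fun i => t i - t 0) hδ _ h0, ← h d (fun i => t i - t 0) (sub_self _)
      (fun i j hij => sub_le_sub_right (hmono hij) _) _ h0, ← distFun_eq_integral_truncPow P hδ h0]
    simp

/-- A once integrated form of the integral relation, between integrals of continuous functions. -/
theorem integralRelation_of_integrated {α : ℝ} (hα : 0 < α) {P Q : ProbabilityMeasure (ℕ → ℝ≥0∞)}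
    (h : ∀ (d : ℕ) (δ : Fin (d + 1) → ℝ), δ 0 = 0 → Monotone δ → ∀ τ : ℝ, 0 ≤ τ →
      ∫ φ, truncPow 1 τ (excess δ φ) ∂(P : Measure (ℕ → ℝ≥0∞)) = 1 / (α + 1) *
        (∫ φ, truncPow (α + 1) τ (excess (fun i => δ i.succ) φ) ∂(Q : Measure (ℕ → ℝ≥0∞)) -
          ∫ φ, truncPow (α + 1) τ (excess δ φ) ∂(Q : Measure (ℕ → ℝ≥0∞)))) :
    IntegralRelation α P Q := by
  rw [integralRelation_iff hα]
  intro d δ h0 hmono τ hτ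
  have h1 := tendsto_slope_integral_truncPow (P : Measure (ℕ → ℝ≥0∞)) (measurable_excess δ)
    le_rfl hτ
  have h2 := tendsto_slope_integral_truncPow (Q : Measure (ℕ → ℝ≥0∞)) (measurable_excess δ)
    hα.le hτ
  have h3 := tendsto_slope_integral_truncPow (Q : Measure (ℕ → ℝ≥0∞))
    (measurable_excess fun i : Fin d => δ i.succ) hα.le hτ
  simp only [zero_add, one_mul] at h1
  have h4 := tendsto_nhds_unique h1 (((h3.sub h2).const_mul (1 / (α + 1))).congr fun n => by
    rw [h d δ h0 hmono _ hτ, h d δ h0 hmono _ (add_nonneg hτ (by positivity))]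
    ring)
  rw [h4]
  field_simp

/-! ### Laws on nondecreasing sequences are determined by their distribution functions -/

theorem generateFrom_range_Iic_pi :
    (MeasurableSpace.pi : MeasurableSpace (ℕ → ℝ≥0∞)) =
      MeasurableSpace.generateFrom (Set.range Set.Iic) := by
  refine le_antisymm (iSup_le fun i => ?_) (MeasurableSpace.generateFrom_le ?_)
  · change MeasurableSpace.comap (fun φ : ℕ → ℝ≥0∞ => φ i) ENNReal.measurableSpace ≤ _
    rw [BorelSpace.measurable_eq (α := ℝ≥0∞), borel_eq_generateFrom_Iic,
      MeasurableSpace.comap_generateFrom]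
    refine MeasurableSpace.generateFrom_le ?_
    rintro _ ⟨_, ⟨c, rfl⟩, rfl⟩
    -- A bound on one coordinate is a lower set whose other bounds are `∞`.
    refine MeasurableSpace.measurableSet_generateFrom ⟨Function.update ⊤ i c, ?_⟩
    ext φ
    simp only [Set.mem_Iic, Set.mem_preimage, Pi.le_def]
    constructor
    · intro h; simpa using h i
    · intro h j
      rcases eq_or_ne j i with rfl | hj
      · simpa using h
      · simp [hj]
  · rintro _ ⟨t, rfl⟩
    exact measurableSet_Iic

/-- Lower sets form a generating π-system, and on nondecreasing sequences arbitrary bounds can be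
replaced by finite nondecreasing ones. Infinitely many constraints are reached by continuity from
above. -/
theorem eq_of_distFun_eq {P P' : ProbabilityMeasure (ℕ → ℝ≥0∞)} (hP : CarriedByMonotone P)
    (hP' : CarriedByMonotone P')
    (h : ∀ (d : ℕ) (t : Fin d → ℝ), (∀ i, 0 ≤ t i) → Monotone t → distFun P d t = distFun P' d t) :
    P = P' := by
  have fin : ∀ (d : ℕ) (t : ℕ → ℝ≥0∞), (P : Measure (ℕ → ℝ≥0∞)) {φ | ∀ i < d, φ i ≤ t i} =
      (P' : Measure (ℕ → ℝ≥0∞)) {φ | ∀ i < d, φ i ≤ t i} := by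
    intro d t
    induction d with
    | zero => simp
    | succ d ih =>
      -- An infinite last bound is void and the dimension drops. A finite last bound makes every
      -- running minimum below finite.
      by_cases hd : t d = ∞
      · have : {φ : ℕ → ℝ≥0∞ | ∀ i < d + 1, φ i ≤ t i} = {φ | ∀ i < d, φ i ≤ t i} := by
          ext φ
          constructor
          · exact fun h i hi => h i (by omega)
          · intro h i hi
            rcases Nat.lt_succ_iff_lt_or_eq.1 hi with h1 | rfl
            · exact h i h1
            · simp [hd]
        rw [this, ih]
      -- For nondecreasing `φ`, `φ i ≤ φ j ≤ t j` for all `j ≥ i`, so the bounds `t` may be replaced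
      -- by their minima over later indices, which are nondecreasing.
      · let s : Fin (d + 1) → ℝ≥0∞ := fun i => ⨅ j ∈ Set.Ici i, t j
        have hs : ∀ i, s i ≠ ∞ := fun i =>
          ne_top_of_le_ne_top hd ((iInf₂_le (Fin.last d) (Fin.le_last i)).trans (by simp))
        have hsm : Monotone s := fun i j hij =>
          le_iInf₂ fun k hk => iInf₂_le k (hij.trans hk)
        have hset : ∀ φ : ℕ → ℝ≥0∞, Monotone φ → ((∀ i < d + 1, φ i ≤ t i) ↔
            ∀ i : Fin (d + 1), φ i ≤ ENNReal.ofReal (s i).toReal) := by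
          intro φ hφ
          constructor
          · intro h i
            rw [ENNReal.ofReal_toReal (hs i)]
            exact le_iInf₂ fun j hj => (hφ (Fin.le_def.1 hj)).trans (h j j.2)
          · intro h i hi
            have := h ⟨i, hi⟩
            rw [ENNReal.ofReal_toReal (hs _)] at this
            exact this.trans (iInf₂_le (⟨i, hi⟩ : Fin (d + 1)) le_rfl)
        have h1 := h (d + 1) (fun i => (s i).toReal) (fun _ => ENNReal.toReal_nonneg)
          fun i j hij => ENNReal.toReal_mono (hs j) (hsm hij)
        have h2 : ∀ R : ProbabilityMeasure (ℕ → ℝ≥0∞), CarriedByMonotone R →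
            (R : Measure (ℕ → ℝ≥0∞)) {φ | ∀ i < d + 1, φ i ≤ t i} =
              (R : Measure (ℕ → ℝ≥0∞))
                {φ | ∀ i : Fin (d + 1), φ i ≤ ENNReal.ofReal (s i).toReal} := fun R hR => by
          refine measure_congr ?_
          filter_upwards [hR] with φ hφ
          exact propext (hset φ hφ)
        rw [h2 P hP, h2 P' hP']
        rwa [distFun, distFun, measureReal_eq_measureReal_iff] at h1
  have : (P : Measure (ℕ → ℝ≥0∞)) Set.univ = (P' : Measure (ℕ → ℝ≥0∞)) Set.univ := by simp
  refine Subtype.ext (ext_of_generate_finite (μ := (P : Measure (ℕ → ℝ≥0∞)))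
    (ν := (P' : Measure (ℕ → ℝ≥0∞))) _ generateFrom_range_Iic_pi ?_ ?_ this)
  · rintro _ ⟨s, rfl⟩ _ ⟨t, rfl⟩ -
    exact ⟨s ⊓ t, Set.Iic_inter_Iic.symm⟩
  · rintro _ ⟨t, rfl⟩
    have hI : Set.Iic t = ⋂ d : ℕ, {φ : ℕ → ℝ≥0∞ | ∀ i < d, φ i ≤ t i} := by
      ext φ
      simp only [Set.mem_Iic, Set.mem_iInter, Set.mem_ofPred_eq, Pi.le_def]
      exact ⟨fun h _ i _ => h i, fun h i => h (i + 1) i (Nat.lt_succ_self i)⟩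
    have hanti : Antitone fun d : ℕ => {φ : ℕ → ℝ≥0∞ | ∀ i < d, φ i ≤ t i} :=
      fun d e hde φ hφ i hi => hφ i (hi.trans_le hde)
    have hmeas : ∀ d : ℕ, MeasurableSet {φ : ℕ → ℝ≥0∞ | ∀ i < d, φ i ≤ t i} := fun d => by
      have : {φ : ℕ → ℝ≥0∞ | ∀ i < d, φ i ≤ t i} = ⋂ i, ⋂ (_ : i < d), {φ | φ i ≤ t i} := by
        ext; simp
      rw [this]
      exact MeasurableSet.iInter fun i => MeasurableSet.iInter fun _ =>
        measurableSet_le (measurable_pi_apply i) measurable_const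
    rw [hI, hanti.measure_iInter (fun d => (hmeas d).nullMeasurableSet) ⟨0, measure_ne_top _ _⟩,
      hanti.measure_iInter (fun d => (hmeas d).nullMeasurableSet) ⟨0, measure_ne_top _ _⟩]
    simp only [fin]

/-! ### Each related law determines the other -/

theorem IntegralRelation.hitting_unique {α : ℝ} {P P' Q : ProbabilityMeasure (ℕ → ℝ≥0∞)}
    (hP : CarriedByMonotone P) (hP' : CarriedByMonotone P')
    (h : IntegralRelation α P Q) (h' : IntegralRelation α P' Q) : P = P' := by
  refine eq_of_distFun_eq hP hP' fun d t ht hmono => ?_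
  cases d with
  | zero => simp [distFun]
  | succ d => rw [h d t (ht 0) hmono, h' d t (ht 0) hmono]

/-- Induction on the dimension: the relation expresses the `α`-moment in dimension `d + 1` through
`P` and the `α`-moment in dimension `d`, and the fractional integral is injective. -/
theorem IntegralRelation.return_unique {α : ℝ} (hα₀ : 0 < α) (hα₁ : α ≤ 1)
    {P Q Q' : ProbabilityMeasure (ℕ → ℝ≥0∞)}
    (hQ : CarriedByMonotone Q) (hQ' : CarriedByMonotone Q')
    (h : IntegralRelation α P Q) (h' : IntegralRelation α P Q') : Q = Q' := by
  refine eq_of_distFun_eq hQ hQ' fun d => ?_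
  induction d with
  | zero => intro t _ _; simp [distFun]
  | succ d ih =>
    intro t ht hmono
    rw [integralRelation_iff hα₀] at h h'
    have hδ : ∀ i, 0 ≤ t i - t 0 := fun i => sub_nonneg.2 (hmono (Fin.zero_le i))
    have hδm : Monotone fun i => t i - t 0 := fun i j hij => sub_le_sub_right (hmono hij) _
    have h1 : ∀ τ, 0 ≤ τ →
        ∫ φ, truncPow α τ (excess (fun i : Fin d => t i.succ - t 0) φ)
          ∂(Q : Measure (ℕ → ℝ≥0∞)) =
        ∫ φ, truncPow α τ (excess (fun i : Fin d => t i.succ - t 0) φ)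
          ∂(Q' : Measure (ℕ → ℝ≥0∞)) := fun τ hτ => by
      rw [← (fractional_integral_distFun Q hα₀ (fun i : Fin d => hδ i.succ) hτ).2,
        ← (fractional_integral_distFun Q' hα₀ (fun i : Fin d => hδ i.succ) hτ).2]
      congr 1
      refine intervalIntegral.integral_congr fun x hx => ?_
      rw [Set.uIcc_of_le hτ] at hx
      rw [ih _ (fun i => add_nonneg (hδ i.succ) hx.1) fun i j hij => ?_]
      exact add_le_add_left (hδm (Fin.succ_le_succ_iff.2 hij)) x
    have h2 : ∀ τ, 0 ≤ τ →
        ∫ φ, truncPow α τ (excess (fun i => t i - t 0) φ) ∂(Q : Measure (ℕ → ℝ≥0∞)) =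
        ∫ φ, truncPow α τ (excess (fun i => t i - t 0) φ) ∂(Q' : Measure (ℕ → ℝ≥0∞)) :=
      fun τ hτ => by
        have e1 := h d (fun i => t i - t 0) (sub_self _) hδm τ hτ
        have e2 := h' d (fun i => t i - t 0) (sub_self _) hδm τ hτ
        have e3 := h1 τ hτ
        linarith
    have h3 := integral_truncPow_zero_eq_of_pos (measurable_excess _) hα₀ hα₁ h2 (ht 0)
    rw [← distFun_eq_integral_truncPow Q hδ (ht 0),
      ← distFun_eq_integral_truncPow Q' hδ (ht 0)] at h3
    simpa using h3

/-! ### Visit times along orbits -/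

/-- Shift of the time variable by one; visits of `x` strictly after time `a + 1` are visits of `T x`
strictly after time `a`. -/
theorem iInf_visit_comp {X : Type*} (T : X → X) (A : Set X) (a : ℕ∞) (x : X) :
    (⨅ (n : ℕ) (_ : a + 1 < (n : ℕ∞) ∧ T^[n] x ∈ A), (n : ℕ∞)) =
      (⨅ (n : ℕ) (_ : a < (n : ℕ∞) ∧ T^[n] (T x) ∈ A), (n : ℕ∞)) + 1 := by
  rw [ENat.iInf_add]
  simp only [ENat.iInf_add]
  refine le_antisymm ?_ ?_
  · refine le_iInf fun n => ?_
    by_cases h : a < (n : ℕ∞) ∧ T^[n] (T x) ∈ A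
    · have h1 : a + 1 < ((n + 1 : ℕ) : ℕ∞) := by
        rw [Nat.cast_add, Nat.cast_one]
        exact (ENat.add_lt_add_iff_right ENat.one_ne_top).2 h.1
      refine (iInf₂_le (n + 1) ⟨h1, h.2⟩).trans (le_iInf fun _ => ?_)
      rw [Nat.cast_add, Nat.cast_one]
    · exact le_iInf fun h' => absurd h' h
  · refine le_iInf₂ fun n hn => ?_
    cases n with
    | zero => simp at hn
    | succ n =>
      have h : a < (n : ℕ∞) ∧ T^[n] (T x) ∈ A := by
        refine ⟨?_, hn.2⟩
        have := hn.1
        push_cast at this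
        exact (ENat.add_lt_add_iff_right ENat.one_ne_top).1 this
      refine (iInf_le _ n).trans ?_
      simp [h]

/-- The visit at time `1` is the first one for `x` but is not counted for `T x`, since visit times
are positive; hence the index drops by one. -/
theorem visitTime_succ_of_mem {X : Type*} {T : X → X} {A : Set X} {x : X} (h : T x ∈ A) (k : ℕ) :
    visitTime T A (k + 1) x = visitTime T A k (T x) + 1 := by
  induction k with
  | zero =>
    refine le_antisymm ?_ ?_
    · exact (iInf₂_le 1 ⟨by simp [visitTime], h⟩).trans (by simp [visitTime])
    · refine le_iInf₂ fun n hn => ?_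
      simp only [visitTime, zero_add, Nat.cast_pos] at hn ⊢
      exact_mod_cast hn.1
  | succ k ih =>
    rw [visitTime, ih, iInf_visit_comp]
    rfl

theorem visitTime_succ_of_notMem {X : Type*} {T : X → X} {A : Set X} {x : X} (h : T x ∉ A) (k : ℕ) :
    visitTime T A (k + 1) x = visitTime T A (k + 1) (T x) + 1 := by
  induction k with
  | zero =>
    have h1 := iInf_visit_comp T A 0 x
    rw [visitTime, visitTime]
    simp only [visitTime]
    rw [← h1]
    refine le_antisymm (le_iInf₂ fun n hn => iInf₂_le n ⟨?_, hn.2⟩)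
      (le_iInf₂ fun n hn => iInf₂_le n ⟨?_, hn.2⟩)
    · exact (zero_le).trans_lt hn.1
    · rw [zero_add]
      refine lt_of_le_of_ne (by exact_mod_cast Nat.one_le_cast.2 (by exact_mod_cast hn.1)) ?_
      intro h2
      have : n = 1 := by exact_mod_cast h2.symm
      exact h (by simpa [this] using hn.2)
  | succ k ih =>
    rw [visitTime, ih, iInf_visit_comp]
    rfl

theorem visitTime_le_succ {X : Type*} (T : X → X) (A : Set X) (k : ℕ) (x : X) :
    visitTime T A k x ≤ visitTime T A (k + 1) x :=
  le_iInf₂ fun _ hn => hn.1.le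

theorem measurable_visitTime {X : Type*} [MeasurableSpace X] {T : X → X} (hT : Measurable T) {A :
    Set X} (hA : MeasurableSet A)
    (k : ℕ) : Measurable (visitTime T A k) := by
  induction k with
  | zero => exact measurable_const
  | succ k ih =>
    have hlt : ∀ c : ℕ∞, MeasurableSet {x | visitTime T A (k + 1) x < c} := fun c => by
      have : {x | visitTime T A (k + 1) x < c} =
          ⋃ n : ℕ, {x | visitTime T A k x < n} ∩ (T^[n] ⁻¹' A ∩ {_x | (n : ℕ∞) < c}) := by
        ext x
        simp [visitTime, iInf_lt_iff, and_assoc]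
      rw [this]
      exact MeasurableSet.iUnion fun n => (ih
        (MeasurableSet.of_discrete (s := Set.Iio (n : ℕ∞)))).inter
        ((hT.iterate n hA).inter (MeasurableSet.const _))
    refine measurable_to_countable' fun c => ?_
    cases c with
    | top =>
      have : visitTime T A (k + 1) ⁻¹' {⊤} = {x | visitTime T A (k + 1) x < ⊤}ᶜ := by
        ext x; simp
      rw [this]
      exact (hlt _).compl
    | coe n =>
      have : visitTime T A (k + 1) ⁻¹' {(n : ℕ∞)} = {x | visitTime T A (k + 1) x < (n : ℕ∞) + 1} \
          {x | visitTime T A (k + 1) x < n} := by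
        ext x
        change visitTime T A (k + 1) x = n ↔ visitTime T A (k + 1) x < (n : ℕ∞) + 1 ∧
          ¬ visitTime T A (k + 1) x < n
        rw [ENat.lt_add_one_iff (ENat.natCast_ne_top n), not_lt, le_antisymm_iff]
      rw [this]
      exact (hlt _).diff (hlt _)

theorem monotone_visitProcess {X : Type*} (T : X → X) (A : Set X) (x : X) :
    Monotone (visitProcess T A x) :=
  monotone_nat_of_le_succ fun i => ENat.toENNReal_mono (visitTime_le_succ T A (i + 1) x)

/-- The visit process, with time measured in units of `1 / γ`. -/
def rescaledVisits {X : Type*} (T : X → X) (A : Set X) (γ : ℝ) (x : X) : ℕ → ℝ≥0∞ :=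
  fun i => ENNReal.ofReal γ * visitProcess T A x i

theorem monotone_rescaledVisits {X : Type*} (T : X → X) (A : Set X) (γ : ℝ) (x : X) :
    Monotone (rescaledVisits T A γ x) :=
  fun _ _ hij => mul_le_mul_right (monotone_visitProcess T A x hij) _

theorem measurable_rescaledVisits {X : Type*} [MeasurableSpace X] {T : X → X} (hT : Measurable T)
    {A : Set X}
    (hA : MeasurableSet A) (γ : ℝ) : Measurable (rescaledVisits T A γ) := by
  refine measurable_pi_lambda _ fun i => ?_
  exact ((Measurable.of_discrete (f := ENat.toENNReal)).comp
    (measurable_visitTime hT hA (i + 1))).const_mul _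

theorem rescaledVisits_of_notMem {X : Type*} {T : X → X} {A : Set X} {γ : ℝ} {x : X} (h : T x ∉ A)
    (i : ℕ) :
    rescaledVisits T A γ x i = rescaledVisits T A γ (T x) i + ENNReal.ofReal γ := by
  simp only [rescaledVisits, visitProcess, visitTime_succ_of_notMem h, ENat.toENNReal_add,
    ENat.toENNReal_one, mul_add, mul_one]

theorem rescaledVisits_zero_of_mem {X : Type*} {T : X → X} {A : Set X} {γ : ℝ} {x : X} (h : T x ∈ A)
    :
    rescaledVisits T A γ x 0 = ENNReal.ofReal γ := by
  have : visitTime T A (0 + 1) x = 1 := by rw [visitTime_succ_of_mem h]; simp [visitTime]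
  simp [rescaledVisits, visitProcess, this]

theorem rescaledVisits_succ_of_mem {X : Type*} {T : X → X} {A : Set X} {γ : ℝ} {x : X} (h : T x ∈ A)
    (i : ℕ) :
    rescaledVisits T A γ x (i + 1) = rescaledVisits T A γ (T x) i + ENNReal.ofReal γ := by
  simp only [rescaledVisits, visitProcess, visitTime_succ_of_mem h, ENat.toENNReal_add,
    ENat.toENNReal_one, mul_add, mul_one]

/-! ### Visit constraints under one time step -/

/-- Truncated subtraction clips the excess at `0`, so `c ≤ t` is a separate condition and survives
when there are no constraints at all. -/
theorem excess_add_le_iff {d : ℕ} {δ : Fin d → ℝ} {φ : ℕ → ℝ≥0∞} {c t : ℝ≥0∞} (hc : c ≠ ∞) :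
    excess δ φ + c ≤ t ↔ c ≤ t ∧ ∀ i : Fin d, φ i + c ≤ t + ENNReal.ofReal (δ i) := by
  have hcan := ENNReal.cancel_of_ne hc
  constructor
  · intro h
    refine ⟨le_add_self.trans h, fun i => ?_⟩
    have h1 := excess_le_iff.1 (le_refl (excess δ φ)) i
    calc φ i + c ≤ excess δ φ + ENNReal.ofReal (δ i) + c := by gcongr
      _ = excess δ φ + c + ENNReal.ofReal (δ i) := by ring
      _ ≤ _ := by gcongr
  · rintro ⟨h1, h2⟩
    rw [← hcan.le_tsub_iff_right h1, excess_le_iff]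
    intro i
    rw [hcan.tsub_add_eq_add_tsub h1, hcan.le_tsub_iff_right (h1.trans le_self_add)]
    exact h2 i

theorem excess_rescaledVisits_of_notMem {X : Type*} {T : X → X} {A : Set X} {γ : ℝ} {x : X} (h :
    T x ∉ A)
    {d : ℕ} {δ : Fin (d + 1) → ℝ} (h0 : δ 0 = 0) {c t : ℝ≥0∞} (hc : c ≠ ∞) :
    excess δ (rescaledVisits T A γ x) + c ≤ t ↔
      excess δ (rescaledVisits T A γ (T x)) + (c + ENNReal.ofReal γ) ≤ t := by
  rw [excess_add_le_iff hc, excess_add_le_iff (ENNReal.add_ne_top.2 ⟨hc, ENNReal.ofReal_ne_top⟩)]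
  simp only [rescaledVisits_of_notMem h]
  have e : ∀ i : Fin (d + 1), rescaledVisits T A γ (T x) i + ENNReal.ofReal γ + c =
      rescaledVisits T A γ (T x) i + (c + ENNReal.ofReal γ) := fun i => by ring
  simp only [e]
  -- Coordinate `0`, with offset `0`, already contains the summand `c + γ`; this gives the missing
  -- bound `c + γ ≤ t`.
  refine ⟨fun h' => ⟨?_, h'.2⟩, fun h' => ⟨le_self_add.trans h'.1, h'.2⟩⟩
  have := h'.2 0
  rw [h0, ENNReal.ofReal_zero, add_zero] at this
  exact le_add_self.trans this

/-- At a visit, coordinate `0` equals `γ`, so its constraint turns into `c + γ ≤ t`. The others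
become the constraints of `T x` with the first offset removed. -/
theorem excess_rescaledVisits_of_mem {X : Type*} {T : X → X} {A : Set X} {γ : ℝ} {x : X} (h :
    T x ∈ A)
    {d : ℕ} {δ : Fin (d + 1) → ℝ} (h0 : δ 0 = 0) {c t : ℝ≥0∞} (hc : c ≠ ∞) :
    excess δ (rescaledVisits T A γ x) + c ≤ t ↔
      excess (fun i => δ i.succ) (rescaledVisits T A γ (T x)) + (c + ENNReal.ofReal γ) ≤ t := by
  rw [excess_add_le_iff hc, excess_add_le_iff (ENNReal.add_ne_top.2 ⟨hc, ENNReal.ofReal_ne_top⟩),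
    Fin.forall_fin_succ]
  simp only [Fin.val_zero, Fin.val_succ, rescaledVisits_zero_of_mem h,
    rescaledVisits_succ_of_mem h, h0, ENNReal.ofReal_zero, add_zero]
  have e : ∀ i : Fin d, rescaledVisits T A γ (T x) i + ENNReal.ofReal γ + c =
      rescaledVisits T A γ (T x) i + (c + ENNReal.ofReal γ) := fun i => by ring
  simp only [e, add_comm (ENNReal.ofReal γ) c]
  exact ⟨fun h' => h'.2, fun h' => ⟨le_self_add.trans h'.1, h'⟩⟩

/-- `1` if the `k`-fold time shift by `γ` of the process still meets the constraint, else `0`. -/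
def shiftInd {d : ℕ} (δ : Fin d → ℝ) (γ τ : ℝ) (φ : ℕ → ℝ≥0∞) (k : ℕ) : ℝ :=
  Set.indicator {φ : ℕ → ℝ≥0∞ | excess δ φ + k * ENNReal.ofReal γ ≤ ENNReal.ofReal τ} 1 φ

/-- The shift must be at least one step: then a zero slack fails the constraint, whether the excess
equals or exceeds `τ`, and the slack alone decides. -/
theorem shiftInd_eq_ite {d : ℕ} (δ : Fin d → ℝ) {γ τ : ℝ} (hγ : 0 < γ) (hτ : 0 ≤ τ)
    (φ : ℕ → ℝ≥0∞) (k : ℕ) :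
    shiftInd δ γ τ φ (k + 1) = if k < ⌊slack τ (excess δ φ) / γ⌋₊ then 1 else 0 := by
  have hiff : excess δ φ + ((k + 1 : ℕ) : ℝ≥0∞) * ENNReal.ofReal γ ≤ ENNReal.ofReal τ ↔
      k < ⌊slack τ (excess δ φ) / γ⌋₊ := by
    rw [← Nat.succ_le_iff, Nat.le_floor_iff (div_nonneg (slack_nonneg _ _) hγ.le),
      le_div_iff₀ hγ]
    have e : ((k + 1 : ℕ) : ℝ≥0∞) * ENNReal.ofReal γ = ENNReal.ofReal ((k + 1 : ℕ) * γ) := by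
      rw [ENNReal.ofReal_mul (by positivity), ENNReal.ofReal_natCast]
    rw [e]
    have hpos : 0 < ((k + 1 : ℕ) : ℝ) * γ := by positivity
    by_cases h : excess δ φ ≤ ENNReal.ofReal τ
    · rw [slack_of_le hτ h]
      have hne := ne_top_of_le_ne_top ENNReal.ofReal_ne_top h
      rw [← ENNReal.ofReal_toReal hne, ← ENNReal.ofReal_add ENNReal.toReal_nonneg hpos.le,
        ENNReal.ofReal_le_ofReal_iff hτ, ENNReal.toReal_ofReal ENNReal.toReal_nonneg,
        Nat.succ_eq_add_one]
      constructor <;> intro <;> linarith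
    · rw [slack_of_lt (not_le.1 h)]
      exact iff_of_false (fun h' => h (le_self_add.trans h')) (not_le.2 hpos)
  unfold shiftInd
  rw [Set.indicator_apply]
  simp only [Set.mem_ofPred_eq, hiff, Pi.one_apply]

theorem shiftInd_zero {d : ℕ} (δ : Fin d → ℝ) (γ τ : ℝ) (φ : ℕ → ℝ≥0∞) :
    shiftInd δ γ τ φ 0 = truncPow 0 τ (excess δ φ) := by
  simp [shiftInd, truncPow_zero, Set.indicator_apply]

theorem abs_shiftInd_le {d : ℕ} (δ : Fin d → ℝ) (γ τ : ℝ) (φ : ℕ → ℝ≥0∞) (k : ℕ) :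
    |shiftInd δ γ τ φ k| ≤ 1 := by
  unfold shiftInd
  rw [Set.indicator_apply]
  split_ifs <;> simp

theorem measurable_shiftInd {d : ℕ} (δ : Fin d → ℝ) (γ τ : ℝ) (k : ℕ) :
    Measurable fun φ => shiftInd δ γ τ φ k :=
  measurable_one.indicator
    (measurableSet_le ((measurable_excess δ).add_const _) measurable_const)

/-- The contribution of a visit at time `k` to the telescoping decomposition. -/
def visitTerm {X : Type*} (T : X → X) (A : Set X) {d : ℕ} (δ : Fin (d + 1) → ℝ) (γ τ : ℝ) (k : ℕ)
    (y : X) : ℝ :=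
  A.indicator (fun y => shiftInd (fun i => δ i.succ) γ τ (rescaledVisits T A γ y) k -
    shiftInd δ γ τ (rescaledVisits T A γ y) k) y

/-- One step of the telescoping: off `A` the indicator is transported unchanged, and on `A` the
correction exchanges the full list of offsets for its tail. -/
theorem shiftInd_step {X : Type*} (T : X → X) (A : Set X) {d : ℕ} {δ : Fin (d + 1) → ℝ} (h0 :
    δ 0 = 0)
    (γ τ : ℝ) (k : ℕ) (x : X) :
    shiftInd δ γ τ (rescaledVisits T A γ x) k =
      shiftInd δ γ τ (rescaledVisits T A γ (T x)) (k + 1) + visitTerm T A δ γ τ (k + 1) (T x) := by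
  have hk : (k : ℝ≥0∞) * ENNReal.ofReal γ ≠ ∞ :=
    ENNReal.mul_ne_top (ENNReal.natCast_ne_top k) ENNReal.ofReal_ne_top
  have e : ((k + 1 : ℕ) : ℝ≥0∞) * ENNReal.ofReal γ =
      k * ENNReal.ofReal γ + ENNReal.ofReal γ := by push_cast; ring
  by_cases h : T x ∈ A
  · rw [visitTerm, Set.indicator_of_mem h, add_sub_cancel]
    simp only [shiftInd, Set.indicator_apply, Set.mem_ofPred_eq, e,
      excess_rescaledVisits_of_mem h h0 hk, Pi.one_apply]
  · rw [visitTerm, Set.indicator_of_notMem h, add_zero]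
    simp only [shiftInd, Set.indicator_apply, Set.mem_ofPred_eq, e,
      excess_rescaledVisits_of_notMem h h0 hk, Pi.one_apply]

theorem shiftInd_eq_sum {X : Type*} (T : X → X) (A : Set X) {d : ℕ} {δ : Fin (d + 1) → ℝ} (h0 :
    δ 0 = 0)
    (γ τ : ℝ) (K : ℕ) (x : X) :
    shiftInd δ γ τ (rescaledVisits T A γ x) 0 =
      shiftInd δ γ τ (rescaledVisits T A γ (T^[K] x)) K +
        ∑ k ∈ Finset.range K, visitTerm T A δ γ τ (k + 1) (T^[k + 1] x) := by
  induction K with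
  | zero => simp
  | succ K ih =>
    rw [ih, shiftInd_step T A h0, Finset.sum_range_succ, Function.iterate_succ_apply']
    ring

/-! ### The decomposition over visits, in integrated form -/

theorem integrable_transferOp_iterate {X : Type*} [MeasurableSpace X] {T : X → X} {μ : Measure X}
    {f : X → ℝ}
    (hf : Integrable f μ) (k : ℕ) : Integrable ((transferOp T μ)^[k] f) μ := by
  induction k with
  | zero => exact hf
  | succ k ih =>
    rw [Function.iterate_succ_apply']
    exact integrable_transferOp ih

theorem integrable_transferSum {X : Type*} [MeasurableSpace X] {T : X → X} {μ : Measure X} {f :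
    X → ℝ}
    (hf : Integrable f μ) (n : ℕ) : Integrable (transferSum T μ f n) μ :=
  integrable_finsetSum _ fun k _ => integrable_transferOp_iterate hf k

theorem integral_mul_comp_iterate {X : Type*} [MeasurableSpace X] {T : X → X} {μ : Measure X}
    [SigmaFinite μ]
    (hT : MeasurePreserving T μ μ) {f : X → ℝ} (hf : Integrable f μ) (k : ℕ) {g : X → ℝ}
    (hg : MemLp g ∞ μ) :
    ∫ x, f x * g (T^[k] x) ∂μ = ∫ x, (transferOp T μ)^[k] f x * g x ∂μ := by
  induction k generalizing g with
  | zero => rfl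
  | succ k ih =>
    rw [Function.iterate_succ_apply',
      ← integral_transferOp_mul hT (integrable_transferOp_iterate hf k) hg,
      ← ih (g := fun x => g (T x)) (hg.comp_measurePreserving hT)]
    simp only [Function.iterate_succ_apply']

theorem measurable_visitTerm {X : Type*} [MeasurableSpace X] {T : X → X} (hT : Measurable T) {A :
    Set X} (hA : MeasurableSet A)
    {d : ℕ} (δ : Fin (d + 1) → ℝ) (γ τ : ℝ) (k : ℕ) : Measurable (visitTerm T A δ γ τ k) :=
  (((measurable_shiftInd _ γ τ k).comp (measurable_rescaledVisits hT hA γ)).sub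
    ((measurable_shiftInd _ γ τ k).comp (measurable_rescaledVisits hT hA γ))).indicator hA

theorem abs_visitTerm_le {X : Type*} (T : X → X) (A : Set X) {d : ℕ} (δ : Fin (d + 1) → ℝ) (γ τ : ℝ)
    (k : ℕ)
    (y : X) : |visitTerm T A δ γ τ k y| ≤ 2 := by
  by_cases h : y ∈ A
  · rw [visitTerm, Set.indicator_of_mem h]
    have h1 := abs_shiftInd_le (fun i : Fin d => δ i.succ) γ τ (rescaledVisits T A γ y) k
    have h2 := abs_shiftInd_le δ γ τ (rescaledVisits T A γ y) k
    exact (abs_sub _ _).trans (by linarith)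
  · simp [visitTerm, Set.indicator_of_notMem h]

theorem memLp_visitTerm {X : Type*} [MeasurableSpace X] {T : X → X} (hT : Measurable T) {A : Set X}
    (hA : MeasurableSet A)
    {d : ℕ} (δ : Fin (d + 1) → ℝ) (γ τ : ℝ) (k : ℕ) (μ : Measure X) :
    MemLp (visitTerm T A δ γ τ k) ∞ μ :=
  memLp_top_of_bound (measurable_visitTerm hT hA δ γ τ k).aestronglyMeasurable 2
    (ae_of_all _ fun y => abs_visitTerm_le T A δ γ τ k y)

/-- The last visit decomposition. -/
theorem integral_mul_truncPow_excess {X : Type*} [MeasurableSpace X] {T : X → X} {μ : Measure X}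
    [SigmaFinite μ]
    (hT : MeasurePreserving T μ μ) {A : Set X} (hA : MeasurableSet A) {f : X → ℝ}
    (hf : Integrable f μ) {d : ℕ} {δ : Fin (d + 1) → ℝ} (h0 : δ 0 = 0) {γ τ : ℝ} (hγ : 0 < γ)
    (hτ : 0 ≤ τ) :
    ∫ x, f x * truncPow 0 τ (excess δ (rescaledVisits T A γ x)) ∂μ =
      ∫ y in A, (transferSum T μ f (⌊slack τ (excess (fun i => δ i.succ)
        (rescaledVisits T A γ y)) / γ⌋₊ + 1) y -
          transferSum T μ f (⌊slack τ (excess δ (rescaledVisits T A γ y)) / γ⌋₊ + 1) y) ∂μ := by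
  -- After `K` steps the accumulated shift exceeds `τ`, so the end term of the telescoping vanishes.
  set K := ⌊τ / γ⌋₊ + 1 with hK
  have hlt : ∀ {e : ℕ} (η : Fin e → ℝ) (φ : ℕ → ℝ≥0∞), ⌊slack τ (excess η φ) / γ⌋₊ ≤ K - 1 :=
    fun η φ => Nat.floor_le_floor (by gcongr; exact slack_le hτ _)
  have hend : ∀ y, shiftInd δ γ τ (rescaledVisits T A γ y) K = 0 := fun y => by
    rw [hK, shiftInd_eq_ite δ hγ hτ, if_neg]
    exact not_lt.2 (hlt _ _)
  have hterm : ∀ k, Integrable (fun x => f x * visitTerm T A δ γ τ (k + 1) (T^[k + 1] x)) μ :=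
    fun k => hf.mul_of_top_left ((memLp_visitTerm hT.measurable hA δ γ τ _ μ).comp_measurePreserving
      (hT.iterate (k + 1)))
  have hterm' : ∀ k, Integrable (fun x => (transferOp T μ)^[k + 1] f x *
      visitTerm T A δ γ τ (k + 1) x) μ := fun k =>
    (integrable_transferOp_iterate hf (k + 1)).mul_of_top_left
      (memLp_visitTerm hT.measurable hA δ γ τ _ μ)
  -- The sum starts at the first iterate. The missing zeroth term `f y` is the same for both offset
  -- lists and cancels in the difference.
  have hsum : ∀ {e : ℕ} (η : Fin e → ℝ) (y : X),
      ∑ k ∈ Finset.range K, (transferOp T μ)^[k + 1] f y *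
        shiftInd η γ τ (rescaledVisits T A γ y) (k + 1) =
      transferSum T μ f (⌊slack τ (excess η (rescaledVisits T A γ y)) / γ⌋₊ + 1) y - f y := by
    intro e η y
    have h1 := hlt η (rescaledVisits T A γ y)
    simp only [shiftInd_eq_ite η hγ hτ, mul_ite, mul_one, mul_zero]
    rw [← Finset.sum_filter, transferSum, Finset.sum_range_succ', Function.iterate_zero_apply,
      add_sub_cancel_right]
    refine Finset.sum_congr ?_ fun _ _ => rfl
    ext k
    simp only [Finset.mem_filter, Finset.mem_range]
    omega
  calc ∫ x, f x * truncPow 0 τ (excess δ (rescaledVisits T A γ x)) ∂μ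
      = ∫ x, ∑ k ∈ Finset.range K, f x * visitTerm T A δ γ τ (k + 1) (T^[k + 1] x) ∂μ := by
        refine integral_congr_ae (ae_of_all _ fun x => ?_)
        simp only
        rw [← shiftInd_zero δ γ, shiftInd_eq_sum T A h0 γ τ K x, hend, zero_add, Finset.mul_sum]
    _ = ∑ k ∈ Finset.range K, ∫ x, f x * visitTerm T A δ γ τ (k + 1) (T^[k + 1] x) ∂μ :=
        integral_finsetSum _ fun k _ => hterm k
    _ = ∑ k ∈ Finset.range K, ∫ x, (transferOp T μ)^[k + 1] f x *
          visitTerm T A δ γ τ (k + 1) x ∂μ :=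
        Finset.sum_congr rfl fun k _ => integral_mul_comp_iterate hT hf (k + 1)
          (memLp_visitTerm hT.measurable hA δ γ τ _ μ)
    _ = ∫ x, ∑ k ∈ Finset.range K, (transferOp T μ)^[k + 1] f x *
          visitTerm T A δ γ τ (k + 1) x ∂μ := (integral_finsetSum _ fun k _ => hterm' k).symm
    _ = _ := by
        rw [← integral_indicator hA]
        refine integral_congr_ae (ae_of_all _ fun y => ?_)
        simp only
        by_cases hy : y ∈ A
        · rw [Set.indicator_of_mem hy]
          simp only [visitTerm, Set.indicator_of_mem hy, mul_sub, Finset.sum_sub_distrib, hsum]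
          ring
        · simp [visitTerm, Set.indicator_of_notMem hy]

/-! ### Weak limits -/

/-- Banach–Alaoglu for the dual ball, transferred by the Riesz isomorphism. -/
theorem exists_weak_ultralimit {E : Type*} [NormedAddCommGroup E] [InnerProductSpace ℝ E]
    [CompleteSpace E] {h : ℕ → E} {R : ℝ} (hR : ∀ n, ‖h n‖ ≤ R) (𝒰 : Ultrafilter ℕ) :
    ∃ e : E, ∀ v : E, Tendsto (fun n => inner ℝ (h n) v) 𝒰 (𝓝 (inner ℝ e v)) := by
  let Λ : ℕ → WeakDual ℝ E := fun n => StrongDual.toWeakDual (InnerProductSpace.toDual ℝ E (h n))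
  have hc := WeakDual.isCompact_closedBall (0 : StrongDual ℝ E) R
  have hΛ : ∀ n, Λ n ∈ WeakDual.toStrongDual ⁻¹' Metric.closedBall (0 : StrongDual ℝ E) R :=
    fun n => by
      simp only [Set.mem_preimage, Metric.mem_closedBall, dist_zero_right]
      exact (LinearIsometryEquiv.norm_map (InnerProductSpace.toDual ℝ E) (h n)).trans_le (hR n)
  obtain ⟨φ, -, hφ⟩ := hc.ultrafilter_le_nhds (𝒰.map Λ)
    (Filter.tendsto_principal.2 (.of_forall hΛ))
  refine ⟨(InnerProductSpace.toDual ℝ E).symm (WeakDual.toStrongDual φ), fun v => ?_⟩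
  have h1 := (tendsto_iff_forall_eval_tendsto_topDualPairing
    (l := (𝒰 : Filter ℕ)) (f := Λ) (x := φ)).1 hφ v
  rw [InnerProductSpace.toDual_symm_apply]
  exact h1

/-- Weak-* compactness in `L∞` over a σ-finite space, reduced to a Hilbert space: for a positive
weight `ρ ∈ L²`, the functions `ρ g_n` are bounded in `L²`, and their weak limit divided by `ρ` is
the desired `G`. -/
theorem exists_weakStar_ultralimit {X : Type*} [MeasurableSpace X] {μ : Measure X} [SigmaFinite μ]
    {g : ℕ → X → ℝ} (hg : ∀ n, Measurable (g n)) {C : ℝ} (hg0 : ∀ n x, 0 ≤ g n x)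
    (hgC : ∀ n x, g n x ≤ C) (𝒰 : Ultrafilter ℕ) :
    ∃ G : X → ℝ, MemLp G ∞ μ ∧ ∀ u : X → ℝ, Integrable u μ →
      Tendsto (fun n => ∫ x, u x * g n x ∂μ) 𝒰 (𝓝 (∫ x, u x * G x ∂μ)) := by
  obtain ⟨ρ₀, hρ₀, hρ₀m, hρ₀i⟩ := exists_pos_lintegral_lt_of_sigmaFinite μ one_ne_zero
  set ρ : X → ℝ := fun x => Real.sqrt (ρ₀ x) with hρdef
  have hρm : Measurable ρ := (hρ₀m.coe_nnreal_real).sqrt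
  have hρ : ∀ x, 0 < ρ x := fun x => Real.sqrt_pos.2 (hρ₀ x)
  have hρ2 : MemLp ρ 2 μ := by
    rw [memLp_two_iff_integrable_sq hρm.aestronglyMeasurable]
    have : (fun x => ρ x ^ 2) = fun x => (ρ₀ x : ℝ) := by
      ext x; exact Real.sq_sqrt (ρ₀ x).2
    rw [this]
    refine ⟨hρ₀m.coe_nnreal_real.aestronglyMeasurable, ?_⟩
    simpa [HasFiniteIntegral] using hρ₀i.trans ENNReal.one_lt_top
  have hC : ∀ x : X, 0 ≤ C := fun x => (hg0 0 x).trans (hgC 0 x)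
  have habs : ∀ n x, ‖g n x‖ ≤ C := fun n x => by
    rw [Real.norm_eq_abs, abs_of_nonneg (hg0 n x)]; exact hgC n x
  have hgL : ∀ n, MemLp (g n) ∞ μ := fun n =>
    memLp_top_of_bound (hg n).aestronglyMeasurable C (ae_of_all _ (habs n))
  have hρg : ∀ n, MemLp (fun x => ρ x * g n x) 2 μ := fun n =>
    (hρ2.const_mul C).mono (hρm.mul (hg n)).aestronglyMeasurable (ae_of_all _ fun x => by
      rw [norm_mul, norm_mul, mul_comm, Real.norm_eq_abs C, abs_of_nonneg (hC x)]
      exact mul_le_mul_of_nonneg_right (habs n x) (norm_nonneg _))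
  obtain ⟨e, he⟩ := exists_weak_ultralimit (h := fun n => (hρg n).toLp)
    (R := ‖(hρ2.const_mul C).toLp‖) (fun n => by
      refine Lp.norm_le_norm_of_ae_le ?_
      filter_upwards [(hρg n).coeFn_toLp, (hρ2.const_mul C).coeFn_toLp] with x h1 h2
      rw [h1, h2, norm_mul, norm_mul, mul_comm, Real.norm_eq_abs C, abs_of_nonneg (hC x)]
      exact mul_le_mul_of_nonneg_right (habs n x) (norm_nonneg _)) 𝒰
  have heL : MemLp (e : X → ℝ) 2 μ := Lp.memLp e
  have hlim : ∀ v : X → ℝ, MemLp v 2 μ → Tendsto (fun n => ∫ x, v x * (ρ x * g n x) ∂μ) 𝒰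
      (𝓝 (∫ x, v x * e x ∂μ)) := by
    intro v hv
    have h1 := he hv.toLp
    simp only [L2.inner_def] at h1
    have e1 : ∫ x, inner ℝ ((e : X → ℝ) x) ((hv.toLp : Lp ℝ 2 μ) x) ∂μ = ∫ x, v x * e x ∂μ := by
      refine integral_congr_ae ?_
      filter_upwards [hv.coeFn_toLp] with x hx
      rw [hx]; simp
    rw [e1] at h1
    refine h1.congr fun n => integral_congr_ae ?_
    filter_upwards [hv.coeFn_toLp, (hρg n).coeFn_toLp] with x h2 h3
    rw [h2, h3]; simp
  have hind : ∀ s : Set X, MeasurableSet s → μ s < ∞ → MemLp (s.indicator fun _ => (1 : ℝ)) 2 μ :=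
    fun s hs hμs => memLp_indicator_const 2 hs 1 (Or.inr hμs.ne)
  have hset : ∀ s : Set X, MeasurableSet s → ∀ v : X → ℝ,
      ∫ x, s.indicator (fun _ => (1 : ℝ)) x * v x ∂μ = ∫ x in s, v x ∂μ := fun s hs v => by
    rw [← integral_indicator hs]
    refine integral_congr_ae (ae_of_all _ fun x => ?_)
    by_cases hx : x ∈ s <;> simp [hx]
  have hon : ∀ v : X → ℝ, MemLp v 2 μ → ∀ s : Set X, MeasurableSet s → μ s < ∞ →
      IntegrableOn v s μ := fun v hv s hs hμs => by
    have : IsFiniteMeasure (μ.restrict s) := ⟨by simpa using hμs⟩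
    exact (hv.restrict s).integrable one_le_two
  -- The bounds `0 ≤ ρ g_n ≤ C ρ` pass to the weak limit by testing on sets of finite measure; they
  -- make `e / ρ` bounded.
  have he0 : 0 ≤ᵐ[μ] (e : X → ℝ) := by
    refine ae_nonneg_of_forall_setIntegral_nonneg_of_sigmaFinite (hon _ heL) fun s hs hμs => ?_
    rw [← hset s hs]
    refine ge_of_tendsto' (hlim _ (hind s hs hμs)) fun n => integral_nonneg fun x => ?_
    exact mul_nonneg (Set.indicator_nonneg (fun _ _ => zero_le_one) _)
      (mul_nonneg (hρ x).le (hg0 n x))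
  have heC : 0 ≤ᵐ[μ] fun x => C * ρ x - e x := by
    refine ae_nonneg_of_forall_setIntegral_nonneg_of_sigmaFinite
      (hon _ ((hρ2.const_mul C).sub heL)) fun s hs hμs => ?_
    rw [integral_sub (hon _ (hρ2.const_mul C) s hs hμs) (hon _ heL s hs hμs), sub_nonneg,
      ← hset s hs]
    refine le_of_tendsto' (hlim _ (hind s hs hμs)) fun n => ?_
    rw [hset s hs]
    refine integral_mono (hon _ (hρg n) s hs hμs) (hon _ (hρ2.const_mul C) s hs hμs) fun x => ?_
    simp only
    rw [mul_comm]
    exact mul_le_mul_of_nonneg_right (hgC n x) (hρ x).le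
  have hGm : AEStronglyMeasurable (fun x => (e : X → ℝ) x / ρ x) μ :=
    (heL.1.aemeasurable.div hρm.aemeasurable).aestronglyMeasurable
  have hGC : ∀ᵐ x ∂μ, ‖(e : X → ℝ) x / ρ x‖ ≤ C := by
    filter_upwards [he0, heC] with x h1 h2
    simp only [Pi.zero_apply] at h1 h2
    rw [Real.norm_eq_abs, abs_of_nonneg (div_nonneg h1 (hρ x).le), div_le_iff₀ (hρ x)]
    linarith
  have hGL : MemLp (fun x => (e : X → ℝ) x / ρ x) ∞ μ := memLp_top_of_bound hGm C hGC
  refine ⟨fun x => e x / ρ x, hGL, fun u hu => ?_⟩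
  -- On `s k` one has `|u| / ρ ≤ k ρ`, so the truncation divided by `ρ` is a legitimate `L²` test
  -- function. The sets exhaust the space, and the truncations approximate `u` in `L¹`.
  let s : ℕ → Set X := fun k => {x | |hu.1.mk u x| ≤ k * ρ x ^ 2}
  have hum := hu.1.stronglyMeasurable_mk.measurable
  have hs : ∀ k, MeasurableSet (s k) := fun k =>
    measurableSet_le hum.abs ((hρm.pow_const 2).const_mul _)
  have hui : Integrable (hu.1.mk u) μ := hu.congr hu.1.ae_eq_mk
  have hv : ∀ k, MemLp (fun x => (s k).indicator (hu.1.mk u) x / ρ x) 2 μ := fun k => by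
    refine (hρ2.const_mul (k : ℝ)).mono ((hum.indicator (hs k)).div hρm).aestronglyMeasurable
      (ae_of_all _ fun x => ?_)
    rw [norm_div, div_le_iff₀ (norm_pos_iff.2 (hρ x).ne')]
    by_cases hx : x ∈ s k
    · rw [Set.indicator_of_mem hx, norm_mul, Real.norm_eq_abs, Real.norm_eq_abs (ρ x),
        abs_of_pos (hρ x), Real.norm_natCast]
      calc |hu.1.mk u x| ≤ k * ρ x ^ 2 := hx
        _ = _ := by ring
    · rw [Set.indicator_of_notMem hx, norm_zero]; positivity
  have happrox : Tendsto (fun k => ∫ x, |hu.1.mk u x - (s k).indicator (hu.1.mk u) x| ∂μ) atTop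
      (𝓝 0) := by
    rw [← integral_zero X ℝ (μ := μ)]
    refine tendsto_integral_of_dominated_convergence (fun x => |hu.1.mk u x|)
      (fun k => (hum.sub (hum.indicator (hs k))).abs.aestronglyMeasurable) hui.abs
      (fun k => ae_of_all _ fun x => ?_) (ae_of_all _ fun x => ?_)
    · by_cases hx : x ∈ s k <;> simp [hx]
    · have h2 : 0 < ρ x ^ 2 := pow_pos (hρ x) 2
      refine tendsto_const_nhds.congr' ?_
      filter_upwards [eventually_ge_atTop ⌈|hu.1.mk u x| / ρ x ^ 2⌉₊] with k hk
      have : x ∈ s k := by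
        have := Nat.le_of_ceil_le hk
        rwa [div_le_iff₀ h2] at this
      simp [this]
  have hbound : ∀ (w : X → ℝ), MemLp w ∞ μ → (∀ᵐ x ∂μ, ‖w x‖ ≤ C) → ∀ k,
      |∫ x, hu.1.mk u x * w x ∂μ - ∫ x, (s k).indicator (hu.1.mk u) x * w x ∂μ| ≤
        C * ∫ x, |hu.1.mk u x - (s k).indicator (hu.1.mk u) x| ∂μ := by
    intro w hw hwC k
    have i1 : Integrable (fun x => hu.1.mk u x * w x) μ := hui.mul_of_top_left hw
    have i2 : Integrable (fun x => (s k).indicator (hu.1.mk u) x * w x) μ :=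
      (hui.indicator (hs k)).mul_of_top_left hw
    rw [← integral_sub i1 i2, ← integral_const_mul]
    refine (abs_integral_le_integral_abs).trans (integral_mono_ae (i1.sub i2).abs
      ((hui.sub (hui.indicator (hs k))).abs.const_mul C) ?_)
    filter_upwards [hwC] with x hx
    rw [← sub_mul, abs_mul, mul_comm]
    exact mul_le_mul_of_nonneg_right hx (abs_nonneg _)
  have hk : ∀ k, Tendsto (fun n => ∫ x, (s k).indicator (hu.1.mk u) x * g n x ∂μ) 𝒰
      (𝓝 (∫ x, (s k).indicator (hu.1.mk u) x * ((e : X → ℝ) x / ρ x) ∂μ)) := fun k => by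
    have h1 := hlim _ (hv k)
    have e1 : ∀ x, (s k).indicator (hu.1.mk u) x / ρ x * e x =
        (s k).indicator (hu.1.mk u) x * ((e : X → ℝ) x / ρ x) := fun x => by ring
    simp only [e1] at h1
    refine h1.congr fun n => integral_congr_ae (ae_of_all _ fun x => ?_)
    have := (hρ x).ne'
    simp only
    field_simp
  have hmk : ∀ w : X → ℝ, ∫ x, u x * w x ∂μ = ∫ x, hu.1.mk u x * w x ∂μ := fun w =>
    integral_congr_ae (by filter_upwards [hu.1.ae_eq_mk] with x hx; rw [hx])
  simp only [hmk]
  rw [Metric.tendsto_nhds]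
  intro ε hε
  have h1 : Tendsto (fun k => C * ∫ x, |hu.1.mk u x - (s k).indicator (hu.1.mk u) x| ∂μ) atTop
      (𝓝 0) := by simpa using happrox.const_mul C
  obtain ⟨k, hk'⟩ := (h1.eventually (gt_mem_nhds (by positivity : 0 < ε / 3))).exists
  filter_upwards [(Metric.tendsto_nhds.1 (hk k)) (ε / 3) (by positivity)] with n hn
  rw [Real.dist_eq] at hn ⊢
  have b1 := hbound (g n) (hgL n) (ae_of_all _ (habs n)) k
  have b2 := hbound _ hGL hGC k
  rw [abs_le] at b1 b2
  rw [abs_lt] at hn ⊢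
  constructor <;> linarith [b1.1, b1.2, b2.1, b2.2, hn.1, hn.2]

/-! ### Positivity of the transfer operator and ergodicity -/

theorem transferOp_nonneg {X : Type*} [MeasurableSpace X] {T : X → X} {μ : Measure X}
    {f : X → ℝ} (hf : 0 ≤ᵐ[μ] f) : 0 ≤ᵐ[μ] transferOp T μ f := by
  have h1 : μ.withDensity (fun y => ENNReal.ofReal (-f y)) = 0 := by
    rw [← withDensity_zero]
    refine withDensity_congr_ae ?_
    filter_upwards [hf] with x hx
    simpa using hx
  have h2 : (Measure.map T (0 : Measure X)).rnDeriv μ =ᵐ[μ] 0 := by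
    rw [Measure.map_zero]
    exact Measure.rnDeriv_zero μ
  filter_upwards [h2] with x hx
  simp only [transferOp, h1, hx, Pi.zero_apply, ENNReal.toReal_zero, sub_zero]
  exact ENNReal.toReal_nonneg

theorem transferOp_iterate_nonneg {X : Type*} [MeasurableSpace X] {T : X → X} {μ : Measure X}
    {f : X → ℝ} (hf : 0 ≤ᵐ[μ] f) (k : ℕ) : 0 ≤ᵐ[μ] (transferOp T μ)^[k] f := by
  induction k with
  | zero => exact hf
  | succ k ih =>
    rw [Function.iterate_succ_apply']
    exact transferOp_nonneg ih

/-- If `s` is invariant and `u` is the indicator of a subset of finite positive measure, duality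
shows that all iterates of the transfer operator on `u` vanish off `s`. Their sum diverges almost
everywhere, so the complement of `s` is null. -/
theorem IsCEMPT.ergodic {X : Type*} [MeasurableSpace X] {T : X → X} {μ : Measure X}
    [SigmaFinite μ] (hT : IsCEMPT T μ) : Ergodic T μ where
  toMeasurePreserving := hT.measurePreserving
  aeconst_set s hs hinv := by
    rw [eventuallyConst_set']
    by_cases h0 : μ s = 0
    · exact Or.inl (ae_eq_empty.2 h0)
    right
    obtain ⟨t, ht, hts, ht0, htt⟩ :=
      Measure.exists_subset_measure_lt_top (r := 0) hs (pos_iff_ne_zero.2 h0)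
    have hui : Integrable (t.indicator fun _ => (1 : ℝ)) μ :=
      (integrable_indicator_iff ht).2 (integrableOn_const htt.ne)
    have hu0 : 0 ≤ᵐ[μ] t.indicator fun _ => (1 : ℝ) :=
      ae_of_all _ fun x => Set.indicator_nonneg (fun _ _ => zero_le_one) x
    have hupos : 0 < ∫ x, t.indicator (fun _ => (1 : ℝ)) x ∂μ := by
      rw [integral_indicator ht, setIntegral_const, smul_eq_mul, mul_one]
      exact ENNReal.toReal_pos ht0.ne' htt.ne
    have hmem : ∀ k x, x ∈ s → T^[k] x ∈ s := fun k x hx => by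
      induction k with
      | zero => exact hx
      | succ k ih =>
        rw [Function.iterate_succ_apply']
        rw [← hinv] at ih
        exact ih
    have hgL : MemLp (sᶜ.indicator fun _ => (1 : ℝ)) ∞ μ :=
      memLp_top_of_bound (measurable_const.indicator hs.compl).aestronglyMeasurable 1
        (ae_of_all _ fun x => by by_cases hx : x ∈ s <;> simp [hx])
    have hzero : ∀ k, ∀ᵐ x ∂μ, x ∈ sᶜ →
        (transferOp T μ)^[k] (t.indicator fun _ => (1 : ℝ)) x = 0 := by
      intro k
      have h1 := integral_mul_comp_iterate hT.measurePreserving hui k hgL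
      have h2 : ∫ x, t.indicator (fun _ => (1 : ℝ)) x *
          sᶜ.indicator (fun _ => (1 : ℝ)) (T^[k] x) ∂μ = 0 := by
        refine integral_eq_zero_of_ae (ae_of_all _ fun x => ?_)
        by_cases hx : x ∈ t
        · have := hmem k x (hts hx)
          simp [this]
        · simp [hx]
      rw [h2] at h1
      have h3 := (integral_eq_zero_iff_of_nonneg_ae ?_
        ((integrable_transferOp_iterate hui k).mul_of_top_left hgL)).1 h1.symm
      · filter_upwards [h3] with x hx hxs
        simpa [hxs] using hx
      · filter_upwards [transferOp_iterate_nonneg (T := T) hu0 k] with x hx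
        exact mul_nonneg hx (Set.indicator_nonneg (fun _ _ => zero_le_one) x)
    refine eventuallyEq_univ.2 ?_
    filter_upwards [ae_all_iff.2 hzero, hT.sum_eq_top _ hui hu0 hupos] with x h1 h2
    by_contra hx
    have : (fun n => transferSum T μ (t.indicator fun _ => (1 : ℝ)) n x) = fun _ => 0 := by
      ext n
      exact Finset.sum_eq_zero fun k _ => h1 k hx
    rw [this] at h2
    exact not_tendsto_const_atTop 0 _ h2

/-- Asymptotically invariant bounded functions are asymptotically constant, weakly. -/
theorem tendsto_integral_mul_of_asymptotically_invariant {X : Type*} [MeasurableSpace X]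
    {T : X → X} {μ : Measure X} [SigmaFinite μ] (hT : Ergodic T μ) {g : ℕ → X → ℝ}
    (hg : ∀ n, Measurable (g n)) {C : ℝ} (hg0 : ∀ n x, 0 ≤ g n x) (hgC : ∀ n x, g n x ≤ C)
    (hinv : ∀ u : X → ℝ, Integrable u μ →
      Tendsto (fun n => ∫ x, u x * (g n (T x) - g n x) ∂μ) atTop (𝓝 0))
    {w : X → ℝ} (hw : Integrable w μ) (hw0 : ∫ x, w x ∂μ = 0) :
    Tendsto (fun n => ∫ x, w x * g n x ∂μ) atTop (𝓝 0) := by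
  rw [tendsto_iff_ultrafilter]
  intro 𝒰 h𝒰
  obtain ⟨G, hG, hlim⟩ := exists_weakStar_ultralimit (μ := μ) hg hg0 hgC 𝒰
  have hTp := hT.toMeasurePreserving
  have hgL : ∀ n, MemLp (g n) ∞ μ := fun n =>
    memLp_top_of_bound (hg n).aestronglyMeasurable C (ae_of_all _ fun x => by
      rw [Real.norm_eq_abs, abs_of_nonneg (hg0 n x)]; exact hgC n x)
  have hGT : MemLp (fun x => G (T x)) ∞ μ := hG.comp_measurePreserving hTp
  -- Asymptotic invariance passes to the ultralimit because composition with `T` moves to the `L¹`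
  -- side as the transfer operator. Ergodicity then makes `G` constant, and constants are
  -- annihilated by `w`.
  have hzero : ∀ u : X → ℝ, Integrable u μ → ∫ x, u x * (G (T x) - G x) ∂μ = 0 := by
    intro u hu
    have h1 := (hlim _ (integrable_transferOp (T := T) hu)).sub (hlim u hu)
    have h2 : ∀ w : X → ℝ, MemLp w ∞ μ → ∫ x, transferOp T μ u x * w x ∂μ - ∫ x, u x * w x ∂μ =
        ∫ x, u x * (w (T x) - w x) ∂μ := by
      intro w hw
      have i1 : Integrable (fun x => u x * w (T x)) μ :=
        hu.mul_of_top_left (hw.comp_measurePreserving hTp)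
      have i2 : Integrable (fun x => u x * w x) μ := hu.mul_of_top_left hw
      rw [← integral_transferOp_mul hTp hu hw, ← integral_sub i1 i2]
      simp only [mul_sub]
    simp only [h2 _ (hgL _), h2 _ hG] at h1
    exact tendsto_nhds_unique h1 ((hinv u hu).mono_left h𝒰)
  have hae : (fun x => G (T x) - G x) =ᵐ[μ] 0 := by
    refine ae_eq_zero_of_forall_setIntegral_eq_of_sigmaFinite (fun s hs hμs => ?_)
      fun s hs hμs => ?_
    · have : IsFiniteMeasure (μ.restrict s) := ⟨by simpa using hμs⟩
      exact ((hGT.sub hG).restrict s).integrable le_top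
    · have h1 := hzero (s.indicator fun _ => (1 : ℝ))
        ((integrable_indicator_iff hs).2 (integrableOn_const hμs.ne))
      rw [← integral_indicator hs, ← h1]
      refine integral_congr_ae (ae_of_all _ fun x => ?_)
      by_cases hx : x ∈ s <;> simp [hx]
  obtain ⟨c, hc⟩ := hT.quasiErgodic.ae_eq_const_of_ae_eq_comp_ae hG.1 (by
    filter_upwards [hae] with x hx
    exact sub_eq_zero.1 hx)
  have h3 : ∫ x, w x * G x ∂μ = 0 := by
    have : ∫ x, w x * G x ∂μ = ∫ x, w x * c ∂μ := by
      refine integral_congr_ae ?_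
      filter_upwards [hc] with x hx
      rw [hx]; rfl
    rw [this, integral_mul_const, hw0, zero_mul]
  have h4 := hlim w hw
  rwa [h3] at h4

/-! ### Monotone normalizing sequences and regular variation -/

theorem ae_abs_le_of_eLpNorm_top_lt {X : Type*} [MeasurableSpace X] {μ : Measure X} {g : X → ℝ}
    {ε : ℝ} (hε : 0 < ε) (h : eLpNorm g ∞ μ < ENNReal.ofReal ε) : ∀ᵐ x ∂μ, |g x| ≤ ε := by
  rw [eLpNorm_exponent_top] at h
  filter_upwards [ae_le_eLpNormEssSup (f := g) (μ := μ)] with x hx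
  have h1 : ‖g x‖ₑ ≤ ENNReal.ofReal ε := hx.trans h.le
  rwa [← ofReal_norm, ENNReal.ofReal_le_ofReal_iff hε.le, Real.norm_eq_abs] at h1

/-- The normalizing sequence of a uniform set is equivalent to a nondecreasing one. -/
theorem exists_monotone_normalizer {X : Type*} [MeasurableSpace X] {μ : Measure X} [SigmaFinite μ]
    {T : X → X} (hT : IsCEMPT T μ) (hPDE : PointwiseDualErgodic T μ) {Y : Set X}
    (hYm : MeasurableSet Y) (hY0 : 0 < μ Y) {a : ℕ → ℝ} {f : X → ℝ} (hf : Integrable f μ)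
    (hf0 : ∫ x, f x ∂μ ≠ 0)
    (hunif : Tendsto (fun n => eLpNorm (fun x => 1 / a n * transferSum T μ f n x - ∫ y, f y ∂μ) ∞
      (μ.restrict Y)) atTop (𝓝 0)) :
    ∃ A : ℕ → ℝ, Monotone A ∧ (∀ n, 0 ≤ A n) ∧ Tendsto A atTop atTop ∧
      Tendsto (fun n => a n / A n) atTop (𝓝 1) := by
  obtain ⟨t, ht, htY, ht0, htt⟩ := Measure.exists_subset_measure_lt_top (r := 0) hYm hY0
  set u : X → ℝ := t.indicator fun _ => (1 : ℝ) with hu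
  have hui : Integrable u μ := (integrable_indicator_iff ht).2 (integrableOn_const htt.ne)
  have hu0 : 0 ≤ᵐ[μ] u := ae_of_all _ fun x => Set.indicator_nonneg (fun _ _ => zero_le_one) x
  have hupos : 0 < ∫ x, u x ∂μ := by
    rw [hu, integral_indicator ht, setIntegral_const, smul_eq_mul, mul_one]
    exact ENNReal.toReal_pos ht0.ne' htt.ne
  obtain ⟨a', ha'⟩ := hPDE
  have hYlim : ∀ᵐ x ∂(μ.restrict Y),
      Tendsto (fun n => 1 / a n * transferSum T μ f n x) atTop (𝓝 (∫ y, f y ∂μ)) := by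
    have h1 : ∀ᵐ x ∂(μ.restrict Y), ∀ k : ℕ, ∀ᶠ n in atTop,
        |1 / a n * transferSum T μ f n x - ∫ y, f y ∂μ| ≤ 1 / ((k : ℝ) + 1) := by
      rw [ae_all_iff]
      intro k
      have hk : 0 < 1 / ((k : ℝ) + 1) := by positivity
      obtain ⟨N, hN⟩ := eventually_atTop.1
        (hunif.eventually (gt_mem_nhds (ENNReal.ofReal_pos.2 hk)))
      have h2 : ∀ᵐ x ∂(μ.restrict Y), ∀ n, N ≤ n →
          |1 / a n * transferSum T μ f n x - ∫ y, f y ∂μ| ≤ 1 / ((k : ℝ) + 1) := by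
        rw [ae_all_iff]
        intro n
        by_cases hn : N ≤ n
        · filter_upwards [ae_abs_le_of_eLpNorm_top_lt hk (hN n hn)] with x hx _ using hx
        · exact ae_of_all _ fun x h => absurd h hn
      filter_upwards [h2] with x hx
      exact eventually_atTop.2 ⟨N, hx⟩
    filter_upwards [h1] with x hx
    rw [Metric.tendsto_nhds]
    intro ε hε
    obtain ⟨k, hk⟩ := exists_nat_one_div_lt hε
    filter_upwards [hx k] with n hn
    exact hn.trans_lt hk
  have hall : ∀ᵐ x ∂(μ.restrict Y), (∀ k, 0 ≤ (transferOp T μ)^[k] u x) ∧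
      Tendsto (fun n => transferSum T μ u n x) atTop atTop ∧
      Tendsto (fun n => 1 / a' n * transferSum T μ u n x) atTop (𝓝 (∫ y, u y ∂μ)) ∧
      Tendsto (fun n => 1 / a' n * transferSum T μ f n x) atTop (𝓝 (∫ y, f y ∂μ)) := by
    refine ae_restrict_of_ae ?_
    filter_upwards [ae_all_iff.2 (transferOp_iterate_nonneg (T := T) hu0),
      hT.sum_eq_top u hui hu0 hupos, ha' u hui, ha' f hf] with x h1 h2 h3 h4
    exact ⟨h1, h2, h3, h4⟩
  have : (ae (μ.restrict Y)).NeBot := by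
    rw [ae_neBot, Ne, Measure.restrict_eq_zero]
    exact hY0.ne'
  -- The new normalizer is read off at one generic point of `Y`: partial sums of a nonnegative
  -- function are monotone and diverge, and pointwise dual ergodicity compares them with those of
  -- the possibly signed `f`.
  obtain ⟨x, ⟨hx0, hxtop, hxu, hxf⟩, hxY⟩ := (hall.and hYlim).exists
  set U := ∫ y, u y ∂μ
  set c := ∫ y, f y ∂μ
  have hA : Tendsto (fun n => transferSum T μ u n x / U) atTop atTop := hxtop.atTop_div_const hupos
  refine ⟨fun n => transferSum T μ u n x / U, ?_, fun n => ?_, hA, ?_⟩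
  · refine monotone_nat_of_le_succ fun n => ?_
    refine div_le_div_of_nonneg_right ?_ hupos.le
    rw [transferSum, transferSum, Finset.sum_range_succ]
    linarith [hx0 n]
  · exact div_nonneg (Finset.sum_nonneg fun k _ => hx0 k) hupos.le
  · have h1 : Tendsto (fun n => transferSum T μ f n x / (transferSum T μ u n x / U)) atTop
        (𝓝 c) := by
      have h2 := (hxf.div hxu hupos.ne').mul_const U
      rw [div_mul_cancel₀ _ hupos.ne'] at h2
      refine h2.congr' ?_
      filter_upwards [hxu.eventually_ne hupos.ne'] with n hn
      have hn1 : a' n ≠ 0 := fun h => hn (by simp [h])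
      have hn2 : transferSum T μ u n x ≠ 0 := fun h => hn (by simp [h])
      simp only [Pi.div_apply]
      field_simp
    have h3 := h1.div hxY hf0
    rw [div_self hf0] at h3
    refine h3.congr' ?_
    filter_upwards [hxY.eventually_ne hf0, hA.eventually_gt_atTop 0] with n hn hn3
    have hn1 : a n ≠ 0 := fun h => hn (by simp [h])
    have hn2 : transferSum T μ f n x ≠ 0 := fun h => hn (by simp [h])
    simp only [Pi.div_apply]
    field_simp

/-- Uniform convergence on `Y` with respect to an equivalent normalizing sequence. -/
theorem uniform_of_equivalent_normalizer {X : Type*} [MeasurableSpace X] {μ : Measure X}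
    {T : X → X} {Y : Set X} {a : ℕ → ℝ} {f : X → ℝ} {c : ℝ}
    (hunif : Tendsto (fun n => eLpNorm (fun x => 1 / a n * transferSum T μ f n x - c) ∞
      (μ.restrict Y)) atTop (𝓝 0)) {A : ℕ → ℝ} (hA : Tendsto A atTop atTop)
    (haA : Tendsto (fun n => a n / A n) atTop (𝓝 1)) {ε : ℝ} (hε : 0 < ε) :
    ∃ m₀, ∀ᵐ y ∂(μ.restrict Y), ∀ n, m₀ ≤ n → |transferSum T μ f n y - c * A n| ≤ ε * A n := by
  have h1 : Tendsto (fun n => |c| * |a n / A n - 1|) atTop (𝓝 0) := by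
    simpa using ((haA.sub_const 1).abs).const_mul |c|
  have hev : ∀ᶠ n in atTop, ∀ᵐ y ∂(μ.restrict Y), |transferSum T μ f n y - c * A n| ≤ ε * A n := by
    filter_upwards [hunif.eventually (gt_mem_nhds (ENNReal.ofReal_pos.2 (by positivity :
      0 < ε / 4))), h1.eventually (gt_mem_nhds (by positivity : 0 < ε / 2)),
      haA.eventually (gt_mem_nhds one_lt_two), haA.eventually (lt_mem_nhds one_half_lt_one),
      hA.eventually_gt_atTop 0] with n h2 h3 h4 h5 hA0
    filter_upwards [ae_abs_le_of_eLpNorm_top_lt (by positivity) h2] with y hy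
    have ha0 : 0 < a n := by
      rw [lt_div_iff₀ hA0] at h5
      linarith
    have ha2 : a n < 2 * A n := by rwa [div_lt_iff₀ hA0] at h4
    have e1 : transferSum T μ f n y - c * A n =
        a n * (1 / a n * transferSum T μ f n y - c) + c * (a n / A n - 1) * A n := by
      field_simp
      ring
    rw [e1]
    refine (abs_add_le _ _).trans ?_
    rw [abs_mul, abs_mul, abs_mul, abs_of_pos ha0, abs_of_pos hA0]
    calc a n * |1 / a n * transferSum T μ f n y - c| + |c| * |a n / A n - 1| * A n
        ≤ (2 * A n) * (ε / 4) + ε / 2 * A n := by gcongr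
      _ = ε * A n := by ring
  obtain ⟨m₀, hm₀⟩ := eventually_atTop.1 hev
  refine ⟨m₀, ?_⟩
  rw [ae_all_iff]
  intro n
  by_cases hn : m₀ ≤ n
  · filter_upwards [hm₀ n hn] with y hy _ using hy
  · exact ae_of_all _ fun y h => absurd h hn

theorem RegularlyVaryingSeq.of_equivalent {a A : ℕ → ℝ} {α : ℝ} (ha : RegularlyVaryingSeq a α)
    (haA : Tendsto (fun n => a n / A n) atTop (𝓝 1)) : RegularlyVaryingSeq A α := by
  intro y hy
  have hf1 : Tendsto (fun x : ℝ => ⌊x * y⌋₊) atTop atTop :=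
    tendsto_nat_floor_atTop.comp (tendsto_id.atTop_mul_const hy)
  have h1 := haA.comp hf1
  have h2 := haA.comp (tendsto_nat_floor_atTop (α := ℝ))
  have h3 := ((ha y hy).mul h2).div h1 one_ne_zero
  rw [mul_one, div_one] at h3
  refine h3.congr' ?_
  filter_upwards [h1.eventually_ne one_ne_zero, h2.eventually_ne one_ne_zero] with x hx1 hx2
  simp only [Function.comp_apply, Pi.div_apply] at *
  have n1 : a ⌊x * y⌋₊ ≠ 0 := fun h => hx1 (by simp [h])
  have n2 : A ⌊x * y⌋₊ ≠ 0 := fun h => hx1 (by simp [h])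
  have n3 : a ⌊x⌋₊ ≠ 0 := fun h => hx2 (by simp [h])
  have n4 : A ⌊x⌋₊ ≠ 0 := fun h => hx2 (by simp [h])
  field_simp

theorem IsAsymptoticInverse.tendsto_div {a : ℕ → ℝ} {b : ℝ → ℝ} (hb : IsAsymptoticInverse a b) :
    Tendsto (fun s => a ⌊b s⌋₊ / s) atTop (𝓝 1) := by
  have h := (Asymptotics.isEquivalent_iff_tendsto_one (by
    filter_upwards [eventually_ne_atTop (0 : ℝ)] with s hs using hs)).1 hb.1
  exact h

theorem IsAsymptoticInverse.tendsto_atTop_atTop {a : ℕ → ℝ} {b : ℝ → ℝ} (hb :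
    IsAsymptoticInverse a b) :
    Tendsto b atTop atTop := by
  have h1 : Tendsto (fun s => a ⌊b s⌋₊) atTop atTop := hb.1.symm.tendsto_atTop tendsto_id
  refine tendsto_atTop.2 fun r => ?_
  obtain ⟨N, hN⟩ := exists_nat_ge r
  obtain ⟨C, hC⟩ := ((Finset.range (N + 1)).image a).bddAbove
  filter_upwards [h1.eventually_gt_atTop C] with s hs
  have h2 : N + 1 ≤ ⌊b s⌋₊ := by
    by_contra h
    exact absurd (hC (Finset.mem_coe.2 (Finset.mem_image_of_mem a
      (Finset.mem_range.2 (not_le.1 h))))) (not_le.2 hs)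
  have h3 := (Nat.le_floor_iff' (Nat.succ_ne_zero N)).1 h2
  push_cast at h3
  linarith

/-- Uniform convergence for nondecreasing regularly varying sequences. -/
theorem RegularlyVaryingSeq.uniform {A : ℕ → ℝ} {α : ℝ} (hα₀ : 0 < α) (hα₁ : α ≤ 1)
    (hA : RegularlyVaryingSeq A α) (hmono : Monotone A) (hnonneg : ∀ n, 0 ≤ A n)
    {γ p : ℕ → ℝ} (hγ0 : ∀ᶠ n in atTop, 0 < γ n) (hγ : Tendsto (fun n => 1 / γ n) atTop atTop)
    (hp0 : ∀ n, 0 ≤ p n) (hp : Tendsto (fun n => p n * A ⌊1 / γ n⌋₊) atTop (𝓝 1))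
    {τ ε : ℝ} (hε : 0 < ε) :
    ∀ᶠ n in atTop, ∀ θ, 0 ≤ θ → θ ≤ τ → |p n * A (⌊θ / γ n⌋₊ + 1) - θ ^ α| ≤ ε := by
  have hpt : ∀ y : ℝ, 0 < y → Tendsto (fun n => p n * A ⌊y / γ n⌋₊) atTop (𝓝 (y ^ α)) := by
    intro y hy
    have h1 := ((hA y hy).comp hγ).mul hp
    rw [mul_one] at h1
    refine h1.congr' ?_
    filter_upwards [hp.eventually_ne one_ne_zero] with n hn
    have : A ⌊1 / γ n⌋₊ ≠ 0 := right_ne_zero_of_mul hn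
    simp only [Function.comp_apply]
    rw [show 1 / γ n * y = y / γ n by ring]
    field_simp
  -- Mesh of a grid on which pointwise convergence is used; monotonicity of `A` fills the gaps, and
  -- `θ ^ α` is subadditive because `α ≤ 1`.
  obtain ⟨η, hη, hηε⟩ : ∃ η : ℝ, 0 < η ∧ (2 * η) ^ α ≤ ε / 2 := by
    refine ⟨(ε / 2) ^ (1 / α) / 2, by positivity, ?_⟩
    rw [mul_div_cancel₀ _ two_ne_zero, ← Real.rpow_mul (by positivity), one_div_mul_cancel hα₀.ne',
      Real.rpow_one]
  have hηε1 : η ^ α ≤ ε / 2 :=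
    (Real.rpow_le_rpow hη.le (by linarith) hα₀.le).trans hηε
  have hgrid : ∀ᶠ n in atTop, ∀ j ∈ Finset.range (⌊τ / η⌋₊ + 3), 0 < j →
      |p n * A ⌊(j * η) / γ n⌋₊ - (j * η) ^ α| ≤ ε / 2 := by
    rw [Filter.eventually_all_finset]
    intro j _
    by_cases hj : 0 < j
    · have := (hpt (j * η) (by positivity)).eventually
        (Metric.closedBall_mem_nhds _ (by positivity : 0 < ε / 2))
      filter_upwards [this] with n hn _
      simpa [Real.dist_eq] using hn
    · exact .of_forall fun n h => absurd h hj
  filter_upwards [hgrid, hγ0, hγ.eventually_ge_atTop (1 / η)] with n hn hγn hγη θ hθ0 hθτ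
  have hηγ : 1 ≤ η / γ n := by
    rw [one_le_div hγn]
    exact (one_div_le_one_div hη hγn).1 hγη
  set j := ⌊θ / η⌋₊ with hj
  have hj1 : j * η ≤ θ := by
    rw [← le_div_iff₀ hη]
    exact Nat.floor_le (by positivity)
  have hj2 : θ ≤ (j + 1) * η := by
    rw [← div_le_iff₀ hη]
    exact (Nat.lt_floor_add_one _).le
  have hjr : j ≤ ⌊τ / η⌋₊ := Nat.floor_le_floor (by gcongr)
  have hup : p n * A (⌊θ / γ n⌋₊ + 1) ≤ θ ^ α + ε := by
    -- Two grid steps up: one to pass `θ`, and one to absorb the extra index `+ 1`, since `1 ≤ η / γ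
    -- n`.
    have h1 := hn (j + 2) (Finset.mem_range.2 (by omega)) (by omega)
    have h2 : ⌊θ / γ n⌋₊ + 1 ≤ ⌊((j + 2 : ℕ) * η) / γ n⌋₊ := by
      rw [← Nat.floor_add_one (by positivity)]
      refine Nat.floor_le_floor ?_
      calc θ / γ n + 1 ≤ (j + 1) * η / γ n + η / γ n := by gcongr
        _ = _ := by push_cast; ring
    have h3 := mul_le_mul_of_nonneg_left (hmono h2) (hp0 n)
    have h4 : (((j + 2 : ℕ) : ℝ) * η) ^ α ≤ θ ^ α + (2 * η) ^ α := by
      refine le_trans (Real.rpow_le_rpow (by positivity) ?_ hα₀.le)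
        (Real.rpow_add_le_add_rpow hθ0 (by positivity) hα₀.le hα₁)
      push_cast
      linarith
    have h5 := (abs_le.1 h1).2
    linarith
  have hlow : θ ^ α - ε ≤ p n * A (⌊θ / γ n⌋₊ + 1) := by
    have h4 : θ ^ α ≤ (j * η) ^ α + η ^ α := by
      refine le_trans (Real.rpow_le_rpow hθ0 (by linarith) hα₀.le)
        (Real.rpow_add_le_add_rpow (by positivity : 0 ≤ (j : ℝ) * η) hη.le hα₀.le hα₁)
    have h2 : ⌊(j * η) / γ n⌋₊ ≤ ⌊θ / γ n⌋₊ + 1 :=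
      (Nat.floor_le_floor (by gcongr)).trans (Nat.le_succ _)
    have h3 := mul_le_mul_of_nonneg_left (hmono h2) (hp0 n)
    rcases Nat.eq_zero_or_pos j with h0 | h0
    · have h6 : 0 ≤ p n * A (⌊θ / γ n⌋₊ + 1) := mul_nonneg (hp0 n) (hnonneg _)
      rw [h0, Nat.cast_zero, zero_mul, Real.zero_rpow hα₀.ne'] at h4
      linarith
    · have h5 := (abs_le.1 (hn j (Finset.mem_range.2 (by omega)) h0)).1
      linarith
  rw [abs_le]
  constructor <;> linarith

/-! ### Hitting integrals in terms of return laws -/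

theorem integrable_comp_index {X : Type*} [MeasurableSpace X] {μ : Measure X} {F : ℕ → X → ℝ}
    (hF : ∀ m, Integrable (F m) μ) {N : X → ℕ} (hN : Measurable N) {K : ℕ} (hK : ∀ x, N x ≤ K) :
    Integrable (fun x => F (N x) x) μ := by
  have h : (fun x => F (N x) x) =
      fun x => ∑ m ∈ Finset.range (K + 1), (N ⁻¹' {m}).indicator (F m) x := by
    ext x
    rw [Finset.sum_eq_single (N x)]
    · simp
    · intro m _ hm
      rw [Set.indicator_of_notMem]
      exact fun h => hm h.symm
    · intro h
      exact absurd (Finset.mem_range.2 (Nat.lt_succ_of_le (hK x))) h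
  rw [h]
  exact integrable_finsetSum _ fun m _ => (hF m).indicator (hN (measurableSet_singleton m))

theorem integral_cond {X : Type*} [MeasurableSpace X] (μ : Measure X) (s : Set X) (g : X → ℝ) :
    ∫ x, g x ∂μ[|s] = (μ s).toReal⁻¹ * ∫ x in s, g x ∂μ := by
  rw [ProbabilityTheory.cond, integral_smul_measure, ENNReal.toReal_inv, smul_eq_mul]

theorem integrableOn_transferSum_floor {X : Type*} [MeasurableSpace X] {μ : Measure X}
    {T : X → X} {f : X → ℝ} (hf : Integrable f μ) {γ τ : ℝ} (hγ : 0 < γ) {θ : X → ℝ}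
    (hθ : Measurable θ) (hθτ : ∀ x, θ x ≤ τ) (s : Set X) :
    IntegrableOn (fun y => transferSum T μ f (⌊θ y / γ⌋₊ + 1) y) s μ :=
  (integrable_comp_index (F := fun m => transferSum T μ f (m + 1))
    (fun m => integrable_transferSum hf (m + 1)) (hθ.div_const γ).nat_floor (K := ⌊τ / γ⌋₊)
    fun x => Nat.floor_le_floor (by gcongr; exact hθτ x)).integrableOn

/-- On `B n ⊆ Y` the sum is close to `c A`, and `μ(B n) A` is close to `θ ^ α`. Both approximations
are uniform, so the random index `θ n y / γ n` is harmless. -/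
theorem tendsto_setIntegral_transferSum_sub {X : Type*} [MeasurableSpace X] {μ : Measure X}
    {T : X → X} {f : X → ℝ} (hf : Integrable f μ) {c : ℝ} {Y : Set X} {A : ℕ → ℝ}
    (hmono : Monotone A) (hnonneg : ∀ n, 0 ≤ A n)
    (hunif : ∀ ε : ℝ, 0 < ε → ∃ m₀, ∀ᵐ y ∂(μ.restrict Y), ∀ n, m₀ ≤ n →
      |transferSum T μ f n y - c * A n| ≤ ε * A n)
    {B : ℕ → Set X} (hBY : ∀ n, B n ⊆ Y)
    (hBpos : ∀ n, μ (B n) ≠ 0) (hBfin : ∀ n, μ (B n) ≠ ∞)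
    (hBrare : Tendsto (fun n => μ (B n)) atTop (𝓝 0)) {γ : ℕ → ℝ} (hγ0 : ∀ᶠ n in atTop, 0 < γ n)
    {α τ : ℝ} (hα : 0 < α) (hτ : 0 ≤ τ)
    (hreg : ∀ ε : ℝ, 0 < ε → ∀ᶠ n in atTop, ∀ θ, 0 ≤ θ → θ ≤ τ →
      |(μ (B n)).toReal * A (⌊θ / γ n⌋₊ + 1) - θ ^ α| ≤ ε)
    {θ : ℕ → X → ℝ} (hθm : ∀ n, Measurable (θ n)) (hθ0 : ∀ n x, 0 ≤ θ n x)
    (hθτ : ∀ n x, θ n x ≤ τ) :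
    Tendsto (fun n => ∫ y in B n, transferSum T μ f (⌊θ n y / γ n⌋₊ + 1) y ∂μ -
      c * ∫ y, θ n y ^ α ∂μ[|B n]) atTop (𝓝 0) := by
  rw [Metric.tendsto_nhds]
  intro ε' hε'
  set K := τ ^ α + 1 + |c| with hK
  have hKpos : 0 < K := by positivity
  obtain ⟨ε, hε, hε1, hεK⟩ : ∃ ε : ℝ, 0 < ε ∧ ε ≤ 1 ∧ ε * K ≤ ε' / 2 := by
    refine ⟨min 1 (ε' / (2 * K)), by positivity, min_le_left _ _, ?_⟩
    calc min 1 (ε' / (2 * K)) * K ≤ ε' / (2 * K) * K := by gcongr; exact min_le_right _ _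
      _ = ε' / 2 := by field_simp
  obtain ⟨m₀, hm₀⟩ := hunif ε hε
  -- Indices below `m₀` escape the uniform estimate. They are dominated by a fixed integrable
  -- function and a constant, whose integrals over `B n` tend to `0`.
  set G₁ : X → ℝ := fun y => ∑ m ∈ Finset.range m₀, |transferSum T μ f m y| with hG₁
  set G₂ : ℝ := ∑ m ∈ Finset.range m₀, |c| * A m with hG₂
  have hG₁i : Integrable G₁ μ := integrable_finsetSum _ fun m _ => (integrable_transferSum hf m).abs
  have hlim1 : Tendsto (fun n => ∫ y in B n, G₁ y ∂μ) atTop (𝓝 0) :=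
    hG₁i.tendsto_setIntegral_nhds_zero hBrare
  have hpr : Tendsto (fun n => (μ (B n)).toReal) atTop (𝓝 0) :=
    (ENNReal.tendsto_toReal ENNReal.zero_ne_top).comp hBrare
  have hlim2 : Tendsto (fun n => ∫ y in B n, G₁ y ∂μ + (μ (B n)).toReal * G₂) atTop (𝓝 0) := by
    simpa using hlim1.add (hpr.mul_const G₂)
  filter_upwards [hlim2.eventually (gt_mem_nhds (by positivity : 0 < ε' / 2)), hγ0, hreg ε hε]
    with n hn hγn hregn
  have hfinB : IsFiniteMeasure (μ.restrict (B n)) :=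
    ⟨by simpa using (hBfin n).lt_top⟩
  set p := (μ (B n)).toReal with hp
  have hppos : 0 < p := ENNReal.toReal_pos (hBpos n) (hBfin n)
  have hθi : IntegrableOn (fun y => θ n y ^ α) (B n) μ :=
    Integrable.of_bound (C := τ ^ α) ((hθm n).pow_const α).aestronglyMeasurable
      (ae_of_all _ fun y => by
        rw [Real.norm_eq_abs, abs_of_nonneg (Real.rpow_nonneg (hθ0 n y) _)]
        exact Real.rpow_le_rpow (hθ0 n y) (hθτ n y) hα.le)
  have hSi := integrableOn_transferSum_floor (T := T) hf hγn (hθm n) (hθτ n) (B n)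
  rw [Real.dist_eq, sub_zero, integral_cond, ← mul_assoc, ← integral_const_mul,
    ← integral_sub hSi (hθi.const_mul _)]
  refine (abs_integral_le_integral_abs).trans_lt ?_
  have hpA := hregn τ hτ le_rfl
  calc ∫ y in B n, |transferSum T μ f (⌊θ n y / γ n⌋₊ + 1) y - c * p⁻¹ * θ n y ^ α| ∂μ
      ≤ ∫ y in B n, (G₁ y + (G₂ + ε * A (⌊τ / γ n⌋₊ + 1) + |c| * p⁻¹ * ε)) ∂μ := by
        refine integral_mono_ae (hSi.sub (hθi.const_mul _)).abs
          (hG₁i.integrableOn.add (integrable_const _)) ?_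
        filter_upwards [ae_mono (Measure.restrict_mono (hBY n) le_rfl) hm₀] with y hy
        set L := ⌊θ n y / γ n⌋₊ + 1 with hL
        have hLA : A L ≤ A (⌊τ / γ n⌋₊ + 1) :=
          hmono (Nat.succ_le_succ (Nat.floor_le_floor (by gcongr; exact hθτ n y)))
        have h1 : |transferSum T μ f L y - c * A L| ≤ G₁ y + G₂ + ε * A (⌊τ / γ n⌋₊ + 1) := by
          have hG₁0 : 0 ≤ G₁ y := Finset.sum_nonneg fun m _ => abs_nonneg _
          have hG₂0 : 0 ≤ G₂ := Finset.sum_nonneg fun m _ => mul_nonneg (abs_nonneg _) (hnonneg m)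
          have h0 : 0 ≤ ε * A (⌊τ / γ n⌋₊ + 1) := mul_nonneg hε.le (hnonneg _)
          rcases le_or_gt m₀ L with h | h
          · refine (hy L h).trans ?_
            have := mul_le_mul_of_nonneg_left hLA hε.le
            linarith
          · have h2 : |transferSum T μ f L y| ≤ G₁ y :=
              Finset.single_le_sum (f := fun m => |transferSum T μ f m y|)
                (fun m _ => abs_nonneg _) (Finset.mem_range.2 h)
            have h3 : |c| * A L ≤ G₂ :=
              Finset.single_le_sum (f := fun m => |c| * A m)
                (fun m _ => mul_nonneg (abs_nonneg _) (hnonneg m)) (Finset.mem_range.2 h)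
            refine (abs_sub _ _).trans ?_
            rw [abs_mul, abs_of_nonneg (hnonneg L)]
            linarith
        have h4 : |c * A L - c * p⁻¹ * θ n y ^ α| ≤ |c| * p⁻¹ * ε := by
          have e1 : c * A L - c * p⁻¹ * θ n y ^ α = c * p⁻¹ * (p * A L - θ n y ^ α) := by
            field_simp
          rw [e1, abs_mul, abs_mul, abs_of_pos (inv_pos.2 hppos)]
          gcongr
          exact hregn _ (hθ0 n y) (hθτ n y)
        have h5 := abs_sub_le (transferSum T μ f L y) (c * A L) (c * p⁻¹ * θ n y ^ α)
        linarith
    _ = ∫ y in B n, G₁ y ∂μ + p * G₂ + (ε * (p * A (⌊τ / γ n⌋₊ + 1)) + |c| * ε) := by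
        rw [integral_add hG₁i.integrableOn (integrable_const _), setIntegral_const, smul_eq_mul,
          measureReal_def, ← hp]
        field_simp
        ring
    _ < ε' / 2 + ε * K := by
        refine add_lt_add_of_lt_of_le hn ?_
        have h6 : p * A (⌊τ / γ n⌋₊ + 1) ≤ τ ^ α + 1 := by linarith [(abs_le.1 hpA).2]
        calc ε * (p * A (⌊τ / γ n⌋₊ + 1)) + |c| * ε ≤ ε * (τ ^ α + 1) + |c| * ε := by gcongr
          _ = ε * K := by rw [hK]; ring
    _ ≤ ε' := by linarith

theorem tendsto_hitting_sub_return {X : Type*} [MeasurableSpace X] {μ : Measure X} [SigmaFinite μ]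
    {T : X → X} (hT : MeasurePreserving T μ μ) {f : X → ℝ} (hf : Integrable f μ) {c : ℝ} {Y : Set X}
    {A : ℕ → ℝ} (hmono : Monotone A) (hnonneg : ∀ n, 0 ≤ A n)
    (hunif : ∀ ε : ℝ, 0 < ε → ∃ m₀, ∀ᵐ y ∂(μ.restrict Y), ∀ n, m₀ ≤ n →
      |transferSum T μ f n y - c * A n| ≤ ε * A n)
    {B : ℕ → Set X} (hBmeas : ∀ n, MeasurableSet (B n)) (hBY : ∀ n, B n ⊆ Y)
    (hBpos : ∀ n, μ (B n) ≠ 0) (hBfin : ∀ n, μ (B n) ≠ ∞)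
    (hBrare : Tendsto (fun n => μ (B n)) atTop (𝓝 0)) {γ : ℕ → ℝ} (hγ0 : ∀ᶠ n in atTop, 0 < γ n)
    {α : ℝ} (hα : 0 < α)
    (hreg : ∀ τ ε : ℝ, 0 < ε → ∀ᶠ n in atTop, ∀ θ, 0 ≤ θ → θ ≤ τ →
      |(μ (B n)).toReal * A (⌊θ / γ n⌋₊ + 1) - θ ^ α| ≤ ε)
    {d : ℕ} {δ : Fin (d + 1) → ℝ} (h0 : δ 0 = 0) {τ : ℝ} (hτ : 0 ≤ τ) :
    Tendsto (fun n => ∫ x, f x * truncPow 0 τ (excess δ (rescaledVisits T (B n) (γ n) x)) ∂μ -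
      c * (∫ x, truncPow α τ (excess (fun i => δ i.succ)
        (rescaledVisits T (B n) (γ n) x)) ∂μ[|B n] -
        ∫ x, truncPow α τ (excess δ (rescaledVisits T (B n) (γ n) x)) ∂μ[|B n])) atTop (𝓝 0) := by
  have hm : ∀ {e : ℕ} (η : Fin e → ℝ) n,
      Measurable fun x => slack τ (excess η (rescaledVisits T (B n) (γ n) x)) := fun η n =>
    (continuous_slack τ).measurable.comp ((measurable_excess η).comp
      (measurable_rescaledVisits hT.measurable (hBmeas n) (γ n)))
  have h1 : ∀ {e : ℕ} (η : Fin e → ℝ), _ := fun {e} η =>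
    tendsto_setIntegral_transferSum_sub hf hmono hnonneg hunif hBY hBpos hBfin hBrare
    hγ0 hα hτ (hreg τ) (θ := fun n x => slack τ (excess η (rescaledVisits T (B n) (γ n) x)))
    (hm η) (fun _ _ => slack_nonneg _ _) (fun _ _ => slack_le hτ _)
  have h2 := (h1 fun i : Fin d => δ i.succ).sub (h1 δ)
  rw [sub_zero] at h2
  refine h2.congr' ?_
  filter_upwards [hγ0] with n hn
  simp only [truncPow_of_pos hα]
  rw [integral_mul_truncPow_excess hT (hBmeas n) hf h0 hn hτ, integral_sub
    (integrableOn_transferSum_floor hf hn (hm _ n) (fun _ => slack_le hτ _) _)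
    (integrableOn_transferSum_floor hf hn (hm _ n) (fun _ => slack_le hτ _) _)]
  ring

/-- Integration over `τ` raises every order by one, so the discontinuous order `0` disappears;
dominated convergence applies since all terms are bounded uniformly in `n`. -/
theorem tendsto_integrated_hitting_sub_return {X : Type*} [MeasurableSpace X] {μ : Measure X}
    [SigmaFinite μ] {f : X → ℝ} (hf : Integrable f μ) {c α : ℝ} (hα : 0 < α)
    {m : ℕ → Measure X} [∀ n, IsProbabilityMeasure (m n)] {M M' : ℕ → X → ℝ≥0∞}
    (hM : ∀ n, Measurable (M n)) (hM' : ∀ n, Measurable (M' n))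
    (h : ∀ τ, 0 ≤ τ → Tendsto (fun n => ∫ x, f x * truncPow 0 τ (M' n x) ∂μ -
      c * (∫ x, truncPow α τ (M n x) ∂(m n) - ∫ x, truncPow α τ (M' n x) ∂(m n))) atTop (𝓝 0))
    {τ : ℝ} (hτ : 0 ≤ τ) :
    Tendsto (fun n => ∫ x, f x * truncPow 1 τ (M' n x) ∂μ - c * (1 / (α + 1) *
      (∫ x, truncPow (α + 1) τ (M n x) ∂(m n) - ∫ x, truncPow (α + 1) τ (M' n x) ∂(m n))))
      atTop (𝓝 0) := by
  have i1 : ∀ n, Integrable (fun _ : X => (1 : ℝ)) (m n) := fun n => integrable_const 1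
  have a1 : ∀ n, IntervalIntegrable (fun x => ∫ y, f y * truncPow 0 x (M' n y) ∂μ) volume 0 τ :=
    fun n => by
      simpa using intervalIntegrable_integral_truncPow hf (hM' n) le_rfl one_pos hτ
  have a2 : ∀ n, IntervalIntegrable (fun x => ∫ y, truncPow α x (M n y) ∂(m n)) volume 0 τ :=
    fun n => by
      simpa using intervalIntegrable_integral_truncPow (i1 n) (hM n) hα.le one_pos hτ
  have a3 : ∀ n, IntervalIntegrable (fun x => ∫ y, truncPow α x (M' n y) ∂(m n)) volume 0 τ :=
    fun n => by
      simpa using intervalIntegrable_integral_truncPow (i1 n) (hM' n) hα.le one_pos hτ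
  have e1 : ∀ n, ∫ x in (0 : ℝ)..τ, (∫ y, f y * truncPow 0 x (M' n y) ∂μ) =
      ∫ x, f x * truncPow 1 τ (M' n x) ∂μ := fun n => by
    simpa [betaConst_one_right le_rfl] using
      integral_integral_truncPow hf (hM' n) le_rfl one_pos hτ
  have e2 : ∀ n, ∫ x in (0 : ℝ)..τ, (∫ y, truncPow α x (M n y) ∂(m n)) =
      1 / (α + 1) * ∫ x, truncPow (α + 1) τ (M n x) ∂(m n) := fun n => by
    simpa [betaConst_one_right hα.le] using
      integral_integral_truncPow (i1 n) (hM n) hα.le one_pos hτ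
  have e3 : ∀ n, ∫ x in (0 : ℝ)..τ, (∫ y, truncPow α x (M' n y) ∂(m n)) =
      1 / (α + 1) * ∫ x, truncPow (α + 1) τ (M' n x) ∂(m n) := fun n => by
    simpa [betaConst_one_right hα.le] using
      integral_integral_truncPow (i1 n) (hM' n) hα.le one_pos hτ
  have key : Tendsto (fun n => ∫ τ in (0 : ℝ)..τ, (∫ x, f x * truncPow 0 τ (M' n x) ∂μ -
      c * (∫ x, truncPow α τ (M n x) ∂(m n) - ∫ x, truncPow α τ (M' n x) ∂(m n)))) atTop
      (𝓝 (∫ _ in (0 : ℝ)..τ, (0 : ℝ))) := by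
    refine intervalIntegral.tendsto_integral_filter_of_dominated_convergence
      (fun _ => ∫ x, |f x| ∂μ + |c| * (τ ^ α + τ ^ α)) (.of_forall fun n => ?_)
      (.of_forall fun n => ae_of_all _ fun x hx => ?_) intervalIntegrable_const
      (ae_of_all _ fun x hx => ?_)
    · rw [Set.uIoc_of_le hτ]
      exact ((a1 n).sub (((a2 n).sub (a3 n)).const_mul c)).1.aestronglyMeasurable
    · rw [Set.uIoc_of_le hτ] at hx
      have b : ∀ N : X → ℝ≥0∞, |∫ y, truncPow α x (N y) ∂(m n)| ≤ τ ^ α := fun N => by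
        have := norm_integral_le_of_norm_le_const (μ := m n) (C := τ ^ α)
          (f := fun y => truncPow α x (N y))
          (ae_of_all _ fun y => abs_truncPow_le hα.le hτ hx.2 (N y))
        simpa using this
      have b' : |∫ y, f y * truncPow 0 x (M' n y) ∂μ| ≤ ∫ x, |f x| ∂μ := by
        refine norm_integral_le_of_norm_le (f := fun y => f y * truncPow 0 x (M' n y)) hf.abs
          (ae_of_all _ fun y => ?_)
        rw [norm_mul]
        refine mul_le_of_le_one_right (norm_nonneg _) ?_
        have := abs_truncPow_le (p := 0) le_rfl hτ hx.2 (M' n y)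
        rwa [Real.rpow_zero] at this
      rw [Real.norm_eq_abs]
      refine (abs_sub _ _).trans (add_le_add b' ?_)
      rw [abs_mul]
      gcongr
      exact (abs_sub _ _).trans (add_le_add (b _) (b _))
    · rw [Set.uIoc_of_le hτ] at hx
      exact h x hx.1.le
  rw [intervalIntegral.integral_zero] at key
  refine key.congr fun n => ?_
  rw [intervalIntegral.integral_sub (a1 n) (((a2 n).sub (a3 n)).const_mul c),
    intervalIntegral.integral_const_mul, intervalIntegral.integral_sub (a2 n) (a3 n), e1, e2, e3,
    mul_sub (1 / (α + 1))]

/-! ### Strong distributional convergence -/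

theorem slack_le_add {τ γ : ℝ} (hγ : 0 ≤ γ) {m m' : ℝ≥0∞} (h : m' ≤ m + ENNReal.ofReal γ) :
    slack τ m ≤ slack τ m' + γ := by
  have h3 : ENNReal.ofReal τ - m' ≠ ∞ := ENNReal.sub_ne_top ENNReal.ofReal_ne_top
  have h1 : ENNReal.ofReal τ - m ≤ (ENNReal.ofReal τ - m') + ENNReal.ofReal γ := by
    rw [tsub_le_iff_right]
    calc ENNReal.ofReal τ ≤ ENNReal.ofReal τ - m' + m' := le_tsub_add
      _ ≤ ENNReal.ofReal τ - m' + (m + ENNReal.ofReal γ) := by gcongr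
      _ = _ := by ring
  have h2 := ENNReal.toReal_mono (ENNReal.add_ne_top.2 ⟨h3, ENNReal.ofReal_ne_top⟩) h1
  rwa [ENNReal.toReal_add h3 ENNReal.ofReal_ne_top, ENNReal.toReal_ofReal hγ] at h2

theorem slack_antitone (τ : ℝ) : Antitone (slack τ) := fun _ _ h =>
  ENNReal.toReal_mono (ENNReal.sub_ne_top ENNReal.ofReal_ne_top) (tsub_le_tsub_left h _)

/-- Away from a visit, each coordinate at `x` is the one at `T x` plus `γ`, and excess and slack are
1-Lipschitz. -/
theorem abs_slack_excess_comp_sub_le {X : Type*} {T : X → X} {A : Set X} {γ τ : ℝ} (hγ : 0 ≤ γ)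
    {x : X} (h : T x ∉ A) {d : ℕ} (δ : Fin d → ℝ) :
    |slack τ (excess δ (rescaledVisits T A γ (T x))) -
      slack τ (excess δ (rescaledVisits T A γ x))| ≤ γ := by
  have h1 : excess δ (rescaledVisits T A γ (T x)) ≤ excess δ (rescaledVisits T A γ x) := by
    refine iSup_mono fun i => tsub_le_tsub_right ?_ _
    rw [rescaledVisits_of_notMem h]
    exact le_self_add
  have h2 : excess δ (rescaledVisits T A γ x) ≤
      excess δ (rescaledVisits T A γ (T x)) + ENNReal.ofReal γ := by
    rw [excess_le_iff]
    intro i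
    rw [rescaledVisits_of_notMem h, add_right_comm]
    gcongr
    exact excess_le_iff.1 le_rfl i
  have h3 := slack_antitone τ h1
  have h4 := slack_le_add (τ := τ) hγ h2
  rw [abs_of_nonneg (sub_nonneg.2 h3)]
  linarith

/-- The integrand changes by at most `γ n` off `T ⁻¹' B n` and by at most `τ` on it; this set has
measure `μ (B n)`, so the integral of `|u|` over it vanishes in the limit. -/
theorem tendsto_integral_slack_comp_sub {X : Type*} [MeasurableSpace X] {μ : Measure X}
    {T : X → X} (hT : MeasurePreserving T μ μ) {B : ℕ → Set X}
    (hBmeas : ∀ n, MeasurableSet (B n)) (hBrare : Tendsto (fun n => μ (B n)) atTop (𝓝 0))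
    {γ : ℕ → ℝ} (hγ0 : ∀ᶠ n in atTop, 0 < γ n) (hγ : Tendsto γ atTop (𝓝 0)) {d : ℕ}
    (δ : Fin d → ℝ) {τ : ℝ} (hτ : 0 ≤ τ) {u : X → ℝ} (hu : Integrable u μ) :
    Tendsto (fun n => ∫ x, u x * (slack τ (excess δ (rescaledVisits T (B n) (γ n) (T x))) -
      slack τ (excess δ (rescaledVisits T (B n) (γ n) x))) ∂μ) atTop (𝓝 0) := by
  have h1 : Tendsto (fun n => γ n * ∫ x, |u x| ∂μ + τ * ∫ x in T ⁻¹' B n, |u x| ∂μ) atTop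
      (𝓝 0) := by
    have h2 : Tendsto (fun n => ∫ x in T ⁻¹' B n, |u x| ∂μ) atTop (𝓝 0) := by
      refine hu.abs.tendsto_setIntegral_nhds_zero ?_
      simp only [Function.comp_def, hT.measure_preimage (hBmeas _).nullMeasurableSet]
      exact hBrare
    simpa using (hγ.mul_const (∫ x, |u x| ∂μ)).add (h2.const_mul τ)
  refine squeeze_zero_norm' ?_ h1
  filter_upwards [hγ0] with n hn
  have hTB : MeasurableSet (T ⁻¹' B n) := hT.measurable (hBmeas n)
  rw [← integral_indicator hTB, ← integral_const_mul, ← integral_const_mul,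
    ← integral_add (hu.abs.const_mul _) ((hu.abs.indicator hTB).const_mul _)]
  refine norm_integral_le_of_norm_le
    ((hu.abs.const_mul _).add ((hu.abs.indicator hTB).const_mul _)) (ae_of_all _ fun x => ?_)
  rw [norm_mul, Real.norm_eq_abs, Real.norm_eq_abs, mul_comm]
  by_cases hx : T x ∈ B n
  · rw [Set.indicator_of_mem (show x ∈ T ⁻¹' B n from hx)]
    have h3 : |slack τ (excess δ (rescaledVisits T (B n) (γ n) (T x))) -
        slack τ (excess δ (rescaledVisits T (B n) (γ n) x))| ≤ τ := by
      rw [abs_sub_le_iff]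
      constructor <;>
      linarith [slack_le hτ (excess δ (rescaledVisits T (B n) (γ n) (T x))),
        slack_le hτ (excess δ (rescaledVisits T (B n) (γ n) x)),
        slack_nonneg τ (excess δ (rescaledVisits T (B n) (γ n) (T x))),
        slack_nonneg τ (excess δ (rescaledVisits T (B n) (γ n) x))]
    have h4 := mul_le_mul_of_nonneg_right h3 (abs_nonneg (u x))
    have h5 := mul_nonneg hn.le (abs_nonneg (u x))
    linarith
  · rw [Set.indicator_of_notMem (show x ∉ T ⁻¹' B n from hx), mul_zero, add_zero]
    exact mul_le_mul_of_nonneg_right (abs_slack_excess_comp_sub_le hn.le hx δ) (abs_nonneg _)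

/-- The asymptotic relation between hitting and return processes. -/
theorem tendsto_integral_hitting_sub_return {X : Type*} [MeasurableSpace X] {μ : Measure X}
    [SigmaFinite μ] {T : X → X} (hT : IsCEMPT T μ) (hPDE : PointwiseDualErgodic T μ) {α : ℝ}
    (hα₀ : 0 < α) (hα₁ : α ≤ 1) {Y : Set X} {a : ℕ → ℝ} (hY : IsUniformSet T μ Y a)
    (ha : RegularlyVaryingSeq a α) {b : ℝ → ℝ} (hb : IsAsymptoticInverse a b) {B : ℕ → Set X}
    (hBmeas : ∀ n, MeasurableSet (B n)) (hBY : ∀ n, B n ⊆ Y) (hBpos : ∀ n, μ (B n) ≠ 0)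
    (hBfin : ∀ n, μ (B n) ≠ ∞) (hBrare : Tendsto (fun n => μ (B n)) atTop (𝓝 0))
    {ν : Measure X} [IsProbabilityMeasure ν] (hν : ν ≪ μ) {d : ℕ} {δ : Fin (d + 1) → ℝ}
    (h0 : δ 0 = 0) {τ : ℝ} (hτ : 0 ≤ τ) :
    Tendsto (fun n => ∫ x, truncPow 1 τ (excess δ (scaledProcess T μ b (B n) x)) ∂ν -
      1 / (α + 1) * (∫ x, truncPow (α + 1) τ (excess (fun i => δ i.succ)
        (scaledProcess T μ b (B n) x)) ∂μ[|B n] -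
          ∫ x, truncPow (α + 1) τ (excess δ (scaledProcess T μ b (B n) x)) ∂μ[|B n]))
      atTop (𝓝 0) := by
  obtain ⟨hYm, hY0, f, hf, hf0, hunif⟩ := hY
  have hTp := hT.measurePreserving
  obtain ⟨A, hAmono, hA0, hAtop, haA⟩ :=
    exists_monotone_normalizer hT hPDE hYm hY0 hf hf0 hunif
  set c := ∫ x, f x ∂μ
  set γ : ℕ → ℝ := fun n => scaling b (μ (B n)).toReal with hγdef
  have hprob : ∀ n, IsProbabilityMeasure (μ[|B n]) := fun n =>
    cond_isProbabilityMeasure_of_finite (hBpos n) (hBfin n)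
  have hp : Tendsto (fun n => (μ (B n)).toReal) atTop (𝓝 0) :=
    (ENNReal.tendsto_toReal ENNReal.zero_ne_top).comp hBrare
  have hppos : ∀ n, 0 < (μ (B n)).toReal := fun n => ENNReal.toReal_pos (hBpos n) (hBfin n)
  have hpinv : Tendsto (fun n => 1 / (μ (B n)).toReal) atTop atTop := by
    simp only [one_div]
    exact (tendsto_nhdsWithin_iff.2 ⟨hp, .of_forall hppos⟩).inv_tendsto_nhdsGT_zero
  have hσ : Tendsto (fun n => b (1 / (μ (B n)).toReal)) atTop atTop :=
    hb.tendsto_atTop_atTop.comp hpinv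
  have hσγ : ∀ n, 1 / γ n = b (1 / (μ (B n)).toReal) := fun n => by
    simp only [hγdef, scaling, one_div_one_div]
  have hγ0 : ∀ᶠ n in atTop, 0 < γ n := by
    filter_upwards [hσ.eventually_gt_atTop 0] with n hn
    exact one_div_pos.2 hn
  have hγ : Tendsto γ atTop (𝓝 0) := by
    simp only [hγdef, scaling, one_div]
    simpa only [one_div, Function.comp_def] using tendsto_inv_atTop_zero.comp hσ
  -- Since `1 / γ n = b (1 / μ(B n))`, this is `a (b s) ∼ s` at `s = 1 / μ(B n)`, with `a` replaced
  -- by the equivalent `A`.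
  have hpA : Tendsto (fun n => (μ (B n)).toReal * A ⌊1 / γ n⌋₊) atTop (𝓝 1) := by
    have h1 := hb.tendsto_div.comp hpinv
    have h2 := haA.comp (tendsto_nat_floor_atTop.comp hσ)
    have h3 := h1.div h2 one_ne_zero
    rw [div_one] at h3
    refine h3.congr' ?_
    filter_upwards [h2.eventually_ne one_ne_zero] with n hn
    simp only [Function.comp_apply, Pi.div_apply] at hn ⊢
    rw [hσγ]
    have n1 : a ⌊b (1 / (μ (B n)).toReal)⌋₊ ≠ 0 := fun h => hn (by rw [h, zero_div])
    have n2 : A ⌊b (1 / (μ (B n)).toReal)⌋₊ ≠ 0 := fun h => hn (by rw [h, div_zero])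
    have n3 := (hppos n).ne'
    field_simp
  have hreg : ∀ τ ε : ℝ, 0 < ε → ∀ᶠ n in atTop, ∀ θ, 0 ≤ θ → θ ≤ τ →
      |(μ (B n)).toReal * A (⌊θ / γ n⌋₊ + 1) - θ ^ α| ≤ ε := fun τ ε hε =>
    (ha.of_equivalent haA).uniform hα₀ hα₁ hAmono hA0 hγ0 (by simpa only [hσγ] using hσ)
      (fun n => (hppos n).le) hpA hε
  have hmeas : ∀ {e : ℕ} (η : Fin e → ℝ) n,
      Measurable fun x => excess η (rescaledVisits T (B n) (γ n) x) := fun η n =>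
    (measurable_excess η).comp (measurable_rescaledVisits hTp.measurable (hBmeas n) (γ n))
  have key := tendsto_integrated_hitting_sub_return hf hα₀ (m := fun n => μ[|B n])
    (hmeas fun i : Fin d => δ i.succ) (hmeas δ) (fun τ hτ =>
      tendsto_hitting_sub_return hTp hf hAmono hA0
        (fun ε hε => uniform_of_equivalent_normalizer hunif hAtop haA hε) hBmeas hBY hBpos hBfin
        hBrare hγ0 hα₀ hreg h0 hτ) hτ
  have hdens : Integrable (fun x => (ν.rnDeriv μ x).toReal) μ := Measure.integrable_toReal_rnDeriv
  -- The density of `ν` and `f / c` have the same integral `1`, so their difference is not seen by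
  -- asymptotically invariant functions.
  have hstrong := tendsto_integral_mul_of_asymptotically_invariant hT.ergodic
    (g := fun n x => slack τ (excess δ (rescaledVisits T (B n) (γ n) x)))
    (fun n => (continuous_slack τ).measurable.comp (hmeas δ n)) (fun _ _ => slack_nonneg _ _)
    (fun _ _ => slack_le hτ _)
    (fun u hu => tendsto_integral_slack_comp_sub hTp hBmeas hBrare hγ0 hγ δ hτ hu)
    (w := fun x => (ν.rnDeriv μ x).toReal - c⁻¹ * f x) (hdens.sub (hf.const_mul _)) (by
      rw [integral_sub hdens (hf.const_mul _), integral_const_mul, inv_mul_cancel₀ hf0,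
        Measure.integral_toReal_rnDeriv hν]
      simp)
  have h2 := hstrong.add (key.const_mul c⁻¹)
  rw [mul_zero, add_zero] at h2
  refine h2.congr fun n => ?_
  have hgL : MemLp (fun x => slack τ (excess δ (rescaledVisits T (B n) (γ n) x))) ∞ μ :=
    memLp_top_of_bound ((continuous_slack τ).measurable.comp (hmeas δ n)).aestronglyMeasurable τ
      (ae_of_all _ fun x => by
        rw [Real.norm_eq_abs, abs_of_nonneg (slack_nonneg _ _)]; exact slack_le hτ _)
  have e1 : ∫ x, ((ν.rnDeriv μ x).toReal - c⁻¹ * f x) *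
      slack τ (excess δ (rescaledVisits T (B n) (γ n) x)) ∂μ =
      ∫ x, truncPow 1 τ (excess δ (rescaledVisits T (B n) (γ n) x)) ∂ν -
        c⁻¹ * ∫ x, f x * truncPow 1 τ (excess δ (rescaledVisits T (B n) (γ n) x)) ∂μ := by
    have i1 : Integrable (fun x => (ν.rnDeriv μ x).toReal *
      slack τ (excess δ (rescaledVisits T (B n) (γ n) x))) μ := hdens.mul_of_top_left hgL
    have i2 : Integrable (fun x => f x *
      slack τ (excess δ (rescaledVisits T (B n) (γ n) x))) μ := hf.mul_of_top_left hgL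
    have e2 := integral_rnDeriv_smul hν
      (f := fun x => slack τ (excess δ (rescaledVisits T (B n) (γ n) x)))
    simp only [smul_eq_mul] at e2
    simp only [truncPow_one, sub_mul, mul_assoc]
    rw [integral_sub i1 (i2.const_mul c⁻¹), integral_const_mul]
    exact congrArg₂ _ e2 rfl
  rw [e1, mul_sub, ← mul_assoc, inv_mul_cancel₀ hf0]
  change _ = ∫ x, truncPow 1 τ (excess δ (rescaledVisits T (B n) (γ n) x)) ∂ν - 1 / (α + 1) *
    (∫ x, truncPow (α + 1) τ (excess (fun i => δ i.succ)
      (rescaledVisits T (B n) (γ n) x)) ∂μ[|B n] -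
      ∫ x, truncPow (α + 1) τ (excess δ (rescaledVisits T (B n) (γ n) x)) ∂μ[|B n])
  ring

/-! ### Limit laws -/

theorem isClosed_monotone_seq : IsClosed {φ : ℕ → ℝ≥0∞ | Monotone φ} := by
  have : {φ : ℕ → ℝ≥0∞ | Monotone φ} = ⋂ i : ℕ, {φ | φ i ≤ φ (i + 1)} := by
    ext φ
    simp only [Set.mem_ofPred_eq, Set.mem_iInter]
    exact ⟨fun h i => h (Nat.le_succ i), monotone_nat_of_le_succ⟩
  rw [this]
  exact isClosed_iInter fun i => isClosed_le (continuous_apply i) (continuous_apply (i + 1))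

/-- Portmanteau inequality for the closed set of nondecreasing sequences. -/
theorem carriedByMonotone_of_tendsto {ι : Type*} {l : Filter ι} [l.NeBot]
    {Pn : ι → ProbabilityMeasure (ℕ → ℝ≥0∞)} {P : ProbabilityMeasure (ℕ → ℝ≥0∞)}
    (h : Tendsto Pn l (𝓝 P)) (hm : ∀ n, CarriedByMonotone (Pn n)) : CarriedByMonotone P := by
  have hcl := isClosed_monotone_seq
  have h1 := ProbabilityMeasure.limsup_measure_closed_le_of_tendsto h hcl
  have h2 : ∀ n, (Pn n : Measure (ℕ → ℝ≥0∞)) {φ : ℕ → ℝ≥0∞ | Monotone φ} = 1 := fun n =>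
    (prob_compl_eq_zero_iff hcl.measurableSet).1 (hm n)
  simp only [h2, limsup_const] at h1
  exact (prob_compl_eq_zero_iff hcl.measurableSet).2 (le_antisymm prob_le_one h1)

/-- The once integrated form of the integral relation holds asymptotically along `l`. -/
def AsymptoticallyRelated {ι : Type*} (l : Filter ι) (α : ℝ)
    (Pn Qn : ι → ProbabilityMeasure (ℕ → ℝ≥0∞)) : Prop :=
  ∀ (d : ℕ) (δ : Fin (d + 1) → ℝ), δ 0 = 0 → Monotone δ → ∀ τ : ℝ, 0 ≤ τ →
    Tendsto (fun n => ∫ φ, truncPow 1 τ (excess δ φ) ∂(Pn n : Measure (ℕ → ℝ≥0∞)) - 1 / (α + 1) *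
      (∫ φ, truncPow (α + 1) τ (excess (fun i => δ i.succ) φ) ∂(Qn n : Measure (ℕ → ℝ≥0∞)) -
        ∫ φ, truncPow (α + 1) τ (excess δ φ) ∂(Qn n : Measure (ℕ → ℝ≥0∞)))) l (𝓝 0)

section Limits

variable {ι : Type*} {l : Filter ι} {α : ℝ} {Pn Qn : ι → ProbabilityMeasure (ℕ → ℝ≥0∞)}
  {P Q : ProbabilityMeasure (ℕ → ℝ≥0∞)}

theorem tendsto_integral_truncPow_excess (h : Tendsto Pn l (𝓝 P)) {p : ℝ} (hp : 0 < p) (τ : ℝ)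
    {d : ℕ} (δ : Fin d → ℝ) :
    Tendsto (fun n => ∫ φ, truncPow p τ (excess δ φ) ∂(Pn n : Measure (ℕ → ℝ≥0∞))) l
      (𝓝 (∫ φ, truncPow p τ (excess δ φ) ∂(P : Measure (ℕ → ℝ≥0∞)))) :=
  (ProbabilityMeasure.tendsto_iff_forall_integral_tendsto.1 h)
    (BoundedContinuousFunction.mkOfCompact
    ⟨fun φ => truncPow p τ (excess δ φ), (continuous_truncPow hp τ).comp (continuous_excess δ)⟩)

theorem AsymptoticallyRelated.integralRelation [l.NeBot] (hα : 0 < α)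
    (h : AsymptoticallyRelated l α Pn Qn) (hP : Tendsto Pn l (𝓝 P)) (hQ : Tendsto Qn l (𝓝 Q)) :
    IntegralRelation α P Q := by
  refine integralRelation_of_integrated hα fun d δ h0 hmono τ hτ => ?_
  have hα1 : 0 < α + 1 := by linarith
  have h1 := (tendsto_integral_truncPow_excess hP one_pos τ δ).sub
    (((tendsto_integral_truncPow_excess hQ hα1 τ fun i : Fin d => δ i.succ).sub
      (tendsto_integral_truncPow_excess hQ hα1 τ δ)).const_mul (1 / (α + 1)))
  exact sub_eq_zero.1 (tendsto_nhds_unique h1 (h d δ h0 hmono τ hτ))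

theorem AsymptoticallyRelated.mono {l' : Filter ι} (h : AsymptoticallyRelated l α Pn Qn)
    (hl : l' ≤ l) : AsymptoticallyRelated l' α Pn Qn :=
  fun d δ h0 hmono τ hτ => (h d δ h0 hmono τ hτ).mono_left hl

/-- Probability measures on the compact space `[0,∞]^ℕ` form a compact space, so no tightness
argument is needed. -/
theorem exists_tendsto_ultrafilter (Rn : ι → ProbabilityMeasure (ℕ → ℝ≥0∞)) (𝒰 : Ultrafilter ι) :
    ∃ R, Tendsto Rn 𝒰 (𝓝 R) := by
  obtain ⟨R, -, hR⟩ := isCompact_univ.ultrafilter_le_nhds (𝒰.map Rn) (by simp)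
  exact ⟨R, hR⟩

theorem AsymptoticallyRelated.exists_hitting [l.NeBot] (hα : 0 < α)
    (h : AsymptoticallyRelated l α Pn Qn) (hPm : ∀ n, CarriedByMonotone (Pn n))
    (hQ : Tendsto Qn l (𝓝 Q)) : ∃ P, CarriedByMonotone P ∧ IntegralRelation α P Q := by
  obtain ⟨P, hP⟩ := exists_tendsto_ultrafilter Pn (Ultrafilter.of l)
  exact ⟨P, carriedByMonotone_of_tendsto hP hPm,
    (h.mono (Ultrafilter.of_le l)).integralRelation hα hP (hQ.mono_left (Ultrafilter.of_le l))⟩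

theorem AsymptoticallyRelated.exists_return [l.NeBot] (hα : 0 < α)
    (h : AsymptoticallyRelated l α Pn Qn) (hQm : ∀ n, CarriedByMonotone (Qn n))
    (hP : Tendsto Pn l (𝓝 P)) : ∃ Q, CarriedByMonotone Q ∧ IntegralRelation α P Q := by
  obtain ⟨Q, hQ⟩ := exists_tendsto_ultrafilter Qn (Ultrafilter.of l)
  exact ⟨Q, carriedByMonotone_of_tendsto hQ hQm,
    (h.mono (Ultrafilter.of_le l)).integralRelation hα (hP.mono_left (Ultrafilter.of_le l)) hQ⟩

/-- Every ultralimit of the hitting laws is related to `Q` and monotone, hence equals `P` by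
uniqueness. -/
theorem AsymptoticallyRelated.tendsto_hitting (hα : 0 < α)
    (h : AsymptoticallyRelated l α Pn Qn) (hPm : ∀ n, CarriedByMonotone (Pn n))
    (hQ : Tendsto Qn l (𝓝 Q)) (hP : CarriedByMonotone P) (hPQ : IntegralRelation α P Q) :
    Tendsto Pn l (𝓝 P) := by
  rw [tendsto_iff_ultrafilter]
  intro 𝒰 h𝒰
  obtain ⟨P', hP'⟩ := exists_tendsto_ultrafilter Pn 𝒰
  rwa [hPQ.hitting_unique hP (carriedByMonotone_of_tendsto hP' hPm)
    ((h.mono h𝒰).integralRelation hα hP' (hQ.mono_left h𝒰))]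

theorem AsymptoticallyRelated.tendsto_return (hα₀ : 0 < α) (hα₁ : α ≤ 1)
    (h : AsymptoticallyRelated l α Pn Qn) (hQm : ∀ n, CarriedByMonotone (Qn n))
    (hP : Tendsto Pn l (𝓝 P)) (hQ : CarriedByMonotone Q) (hPQ : IntegralRelation α P Q) :
    Tendsto Qn l (𝓝 Q) := by
  rw [tendsto_iff_ultrafilter]
  intro 𝒰 h𝒰
  obtain ⟨Q', hQ'⟩ := exists_tendsto_ultrafilter Qn 𝒰
  rwa [hPQ.return_unique hα₀ hα₁ hQ (carriedByMonotone_of_tendsto hQ' hQm)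
    ((h.mono h𝒰).integralRelation hα₀ (hP.mono_left h𝒰) hQ')]

end Limits

/-! ### Laws of visit processes -/

/-- The law of the scaled process of visits to `A` under `ν`. -/
def visitLaw {X : Type*} [MeasurableSpace X] {T : X → X} (hT : Measurable T) (μ : Measure X)
    (b : ℝ → ℝ) {A : Set X} (hA : MeasurableSet A) (ν : Measure X) [IsProbabilityMeasure ν] :
    ProbabilityMeasure (ℕ → ℝ≥0∞) :=
  ⟨ν.map (scaledProcess T μ b A),
    Measure.isProbabilityMeasure_map (measurable_rescaledVisits hT hA _).aemeasurable⟩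

theorem integral_visitLaw {X : Type*} [MeasurableSpace X] {T : X → X} (hT : Measurable T)
    (μ : Measure X) (b : ℝ → ℝ) {A : Set X} (hA : MeasurableSet A) (ν : Measure X)
    [IsProbabilityMeasure ν] {F : (ℕ → ℝ≥0∞) → ℝ} (hF : Measurable F) :
    ∫ φ, F φ ∂(visitLaw hT μ b hA ν : Measure (ℕ → ℝ≥0∞)) =
      ∫ x, F (scaledProcess T μ b A x) ∂ν :=
  integral_map (measurable_rescaledVisits hT hA _).aemeasurable hF.aestronglyMeasurable

theorem carriedByMonotone_visitLaw {X : Type*} [MeasurableSpace X] {T : X → X} (hT : Measurable T)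
    (μ : Measure X) (b : ℝ → ℝ) {A : Set X} (hA : MeasurableSet A) (ν : Measure X)
    [IsProbabilityMeasure ν] : CarriedByMonotone (visitLaw hT μ b hA ν) :=
  (ae_map_iff (measurable_rescaledVisits hT hA _).aemeasurable
    isClosed_monotone_seq.measurableSet).2 (ae_of_all _ fun x => monotone_rescaledVisits T A _ x)

theorem tendstoInDistribution_scaledProcess_iff {X : Type*} [MeasurableSpace X] {T : X → X}
    (hT : Measurable T) (μ : Measure X) (b : ℝ → ℝ) {B : ℕ → Set X}
    (hB : ∀ n, MeasurableSet (B n)) (ν : ℕ → Measure X) [∀ n, IsProbabilityMeasure (ν n)]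
    (P : ProbabilityMeasure (ℕ → ℝ≥0∞)) :
    TendstoInDistribution (fun n => scaledProcess T μ b (B n)) atTop id ν
      (P : Measure (ℕ → ℝ≥0∞)) ↔
    Tendsto (fun n => visitLaw hT μ b (hB n) (ν n)) atTop (𝓝 P) := by
  have hid : ∀ h, (⟨(P : Measure (ℕ → ℝ≥0∞)).map id, h⟩ : ProbabilityMeasure (ℕ → ℝ≥0∞)) = P :=
    fun h => Subtype.ext Measure.map_id
  constructor
  · intro h
    have := h.tendsto
    rwa [hid] at this
  · intro h
    refine ⟨fun n => (measurable_rescaledVisits hT (hB n) _).aemeasurable, aemeasurable_id, ?_⟩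
    rwa [hid]

theorem asymptoticallyRelated_visitLaw {X : Type*} [MeasurableSpace X] {μ : Measure X}
    [SigmaFinite μ] {T : X → X} (hT : IsCEMPT T μ) (hPDE : PointwiseDualErgodic T μ) {α : ℝ}
    (hα₀ : 0 < α) (hα₁ : α ≤ 1) {Y : Set X} {a : ℕ → ℝ} (hY : IsUniformSet T μ Y a)
    (ha : RegularlyVaryingSeq a α) {b : ℝ → ℝ} (hb : IsAsymptoticInverse a b) {B : ℕ → Set X}
    (hBmeas : ∀ n, MeasurableSet (B n)) (hBY : ∀ n, B n ⊆ Y) (hBpos : ∀ n, μ (B n) ≠ 0)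
    (hBfin : ∀ n, μ (B n) ≠ ∞) (hBrare : Tendsto (fun n => μ (B n)) atTop (𝓝 0))
    {ν : Measure X} [IsProbabilityMeasure ν] (hν : ν ≪ μ)
    [∀ n, IsProbabilityMeasure (μ[|B n])] :
    AsymptoticallyRelated atTop α
      (fun n => visitLaw hT.measurePreserving.measurable μ b (hBmeas n) ν)
      (fun n => visitLaw hT.measurePreserving.measurable μ b (hBmeas n) (μ[|B n])) := by
  intro d δ h0 _ τ hτ
  have hm : ∀ {e : ℕ} (η : Fin e → ℝ) p, Measurable fun φ => truncPow p τ (excess η φ) :=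
    fun η p => (measurable_truncPow p τ).comp (measurable_excess η)
  simp only [integral_visitLaw _ _ _ _ _ (hm _ _)]
  exact tendsto_integral_hitting_sub_return hT hPDE hα₀ hα₁ hY ha hb hBmeas hBY hBpos hBfin
    hBrare hν h0 hτ

end HittingReturn

end

/-! ### Assembly of the theorem -/

open HittingReturn

theorem mainTheorem1 {X : Type*} [MeasurableSpace X] (μ : MeasureTheory.Measure X)
    [MeasureTheory.SigmaFinite μ] (hμ : μ Set.univ = ∞)
    (T : X → X) (hT : HittingReturn.IsCEMPT T μ) (hPDE : HittingReturn.PointwiseDualErgodic T μ)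
    (α : ℝ) (hα₀ : 0 < α) (hα₁ : α ≤ 1)
    (Y : Set X) (a : ℕ → ℝ) (hY : HittingReturn.IsUniformSet T μ Y a)
    (ha : HittingReturn.RegularlyVaryingSeq a α)
    (b : ℝ → ℝ) (hb : HittingReturn.IsAsymptoticInverse a b)
    (B : ℕ → Set X) (hBmeas : ∀ n, MeasurableSet (B n)) (hBY : ∀ n, B n ⊆ Y)
    (hBpos : ∀ n, μ (B n) ≠ 0) (hBfin : ∀ n, μ (B n) ≠ ∞)
    (hBrare : Tendsto (fun n => μ (B n)) atTop (𝓝 0)) :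
    -- the return processes converge in law iff the hitting processes converge strongly in law
    ((∃ Q, HittingReturn.ReturnConverges T μ b B hBpos hBfin Q) ↔
      ∃ P, HittingReturn.HittingConverges T μ b B P) ∧
    -- the limits are carried by nondecreasing sequences and satisfy the integral relation
    (∀ P Q, HittingReturn.ReturnConverges T μ b B hBpos hBfin Q →
      HittingReturn.HittingConverges T μ b B P →
        HittingReturn.CarriedByMonotone P ∧ HittingReturn.CarriedByMonotone Q ∧
          HittingReturn.IntegralRelation α P Q) ∧
    -- for related laws, convergence to one is equivalent to convergence to the other
    (∀ P Q, HittingReturn.CarriedByMonotone P → HittingReturn.CarriedByMonotone Q →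
      HittingReturn.IntegralRelation α P Q →
        (HittingReturn.ReturnConverges T μ b B hBpos hBfin Q ↔
          HittingReturn.HittingConverges T μ b B P)) ∧
    -- the integral relation determines each of the two laws from the other
    (∀ P P' Q Q', HittingReturn.CarriedByMonotone P → HittingReturn.CarriedByMonotone P' →
      HittingReturn.CarriedByMonotone Q → HittingReturn.CarriedByMonotone Q' →
      HittingReturn.IntegralRelation α P Q → HittingReturn.IntegralRelation α P' Q' →
        (P = P' ↔ Q = Q')) := by
  have hprob : ∀ n, IsProbabilityMeasure (μ[|B n]) := fun n =>
    cond_isProbabilityMeasure_of_finite (hBpos n) (hBfin n)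
  have hTm := hT.measurePreserving.measurable
  have hrel : ∀ (ν : Measure X) [IsProbabilityMeasure ν], ν ≪ μ → AsymptoticallyRelated atTop α
      (fun n => visitLaw hTm μ b (hBmeas n) ν) (fun n => visitLaw hTm μ b (hBmeas n) (μ[|B n])) :=
    fun ν _ hν => asymptoticallyRelated_visitLaw hT hPDE hα₀ hα₁ hY ha hb hBmeas hBY hBpos hBfin
      hBrare hν
  have hRm : ∀ n, CarriedByMonotone (visitLaw hTm μ b (hBmeas n) (μ[|B n])) := fun n =>
    carriedByMonotone_visitLaw hTm μ b (hBmeas n) _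
  have hHm : ∀ (ν : Measure X) [IsProbabilityMeasure ν],
      ∀ n, CarriedByMonotone (visitLaw hTm μ b (hBmeas n) ν) := fun ν _ n =>
    carriedByMonotone_visitLaw hTm μ b (hBmeas n) ν
  have hR : ∀ Q, ReturnConverges T μ b B hBpos hBfin Q ↔
      Tendsto (fun n => visitLaw hTm μ b (hBmeas n) (μ[|B n])) atTop (𝓝 Q) := fun Q =>
    tendstoInDistribution_scaledProcess_iff hTm μ b hBmeas (fun n => μ[|B n]) Q
  have hH : ∀ P, HittingConverges T μ b B P ↔ ∀ (ν : Measure X) [IsProbabilityMeasure ν], ν ≪ μ →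
      Tendsto (fun n => visitLaw hTm μ b (hBmeas n) ν) atTop (𝓝 P) := fun P =>
    forall_congr' fun ν => forall_congr' fun _ => forall_congr' fun _ =>
      tendstoInDistribution_scaledProcess_iff hTm μ b hBmeas (fun _ => ν) P
  -- A single `ν ≪ μ` suffices for identifying limits and for passing from hitting to return; the
  -- conditional measure on `B 0` is one at hand.
  have hac : μ[|B 0] ≪ μ := cond_absolutelyContinuous
  have hrelated : ∀ P Q, ReturnConverges T μ b B hBpos hBfin Q → HittingConverges T μ b B P →
      CarriedByMonotone P ∧ CarriedByMonotone Q ∧ IntegralRelation α P Q := by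
    intro P Q hQ hP
    have hP0 := (hH P).1 hP _ hac
    exact ⟨carriedByMonotone_of_tendsto hP0 (hHm _),
      carriedByMonotone_of_tendsto ((hR Q).1 hQ) hRm,
      (hrel _ hac).integralRelation hα₀ hP0 ((hR Q).1 hQ)⟩
  have htoH : ∀ P Q, CarriedByMonotone P → IntegralRelation α P Q →
      ReturnConverges T μ b B hBpos hBfin Q → HittingConverges T μ b B P := fun P Q hP hPQ hQ =>
    (hH P).2 fun ν _ hν => (hrel ν hν).tendsto_hitting hα₀ (hHm ν) ((hR Q).1 hQ) hP hPQ
  have htoR : ∀ P Q, CarriedByMonotone Q → IntegralRelation α P Q →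
      HittingConverges T μ b B P → ReturnConverges T μ b B hBpos hBfin Q := fun P Q hQ hPQ hP =>
    (hR Q).2 ((hrel _ hac).tendsto_return hα₀ hα₁ hRm ((hH P).1 hP _ hac) hQ hPQ)
  refine ⟨⟨?_, ?_⟩, hrelated, ?_, ?_⟩
  · rintro ⟨Q, hQ⟩
    -- The candidate is found with one `ν`, but being related to `Q` does not involve `ν`, so the
    -- same `P` is the limit for all of them.
    obtain ⟨P, hP, hPQ⟩ := (hrel _ hac).exists_hitting hα₀ (hHm _) ((hR Q).1 hQ)
    exact ⟨P, htoH P Q hP hPQ hQ⟩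
  · rintro ⟨P, hP⟩
    obtain ⟨Q, hQ, hPQ⟩ := (hrel _ hac).exists_return hα₀ hRm ((hH P).1 hP _ hac)
    exact ⟨Q, htoR P Q hQ hPQ hP⟩
  · exact fun P Q hP hQ hPQ => ⟨htoH P Q hP hPQ, htoR P Q hQ hPQ⟩
  · intro P P' Q Q' hP hP' hQ hQ' h h'
    constructor
    · rintro rfl
      exact h.return_unique hα₀ hα₁ hQ hQ' h'
    · rintro rfl
      exact h.hitting_unique hP hP' h'
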